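/- **Setting.** Let $n\ge 2$ be a known horizon, $\delta\in(0,1]$, $\sigma\ge 0$ known, and $\theta_{1:n}=(\theta_1,\dots,\theta_n)\in\mathbb R^n$ a fixed sequence. The feedback is $y_t=\theta_t+Z_t$, $t=1,\dots,n$, where $Z_1,\dots,Z_n$ are independent, zero-mean, $\sigma$-subgaussian random variables (i.e. $\mathbb E e^{sZ_t}\le e^{\sigma^2s^2/2}$ for all $s\in\mathbb R$); put $y_0=0$. Let $D\theta_{1:n}=(\theta_2-\theta_1,\dots,\theta_n-\theta_{n-1})$. A forecaster plays $x_t$ before it sees $y_t$; with the losses $\ell_t(x)=(x-\theta_t)^2$ its (realized) dynamic regret is $R_n=\sum_{t=1}^n\ell_t(x_t)-\sum_{t=1}^n\inf_{x\in\mathbb R}\ell_t(x)=\sum_{t=1}^n(x_t-\theta_t)^2$. **The policy ARROWS** (parameters $n,\sigma,\beta$). Write $\bar y_{a:b}$ for the average of $y_a,\dots,y_b$, and let $\mathrm{pad}_0(y_a,\dots,y_b)$ be the vector $(y_a-\bar y_{a:b},\dots,y_b-\bar y_{a:b})$ padded by zeros at the end until its length is the next power of two (no padding if it already is one). Let $H$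 be the orthogonal discrete Haar wavelet transform matrix of the size in question; for a vector $\alpha=Hx$ of length $k=2^m$ let $\alpha[l]$, $0\le l<m$, be the block of its $2^l$ wavelet coefficients of level $l$ (those of the wavelets whose support has length $k/2^l$), the remaining coefficient being that of the constant vector. Let $T$ be the coordinatewise soft thresholding with threshold $\sigma\sqrt{\beta\log n}$. Start with $t_h=1$ and $\mathrm{newBin}=1$. For $t=1,\dots,n$: predict $x_t=y_{t-1}$ if $\mathrm{newBin}=1$, and $x_t=\bar y_{t_h:t-1}$ otherwise; set $\mathrm{newBin}=0$ and observe $y_t$; let $\hat\alpha=T(H\,\mathrm{pad}_0(y_{t_h},\dots,y_t))$, of length $k=2^m$; if $\frac1{\sqrt k}\sum_{l=0}^{m-1}2^{l/2}\|\hat\alpha[l]\|_1>\frac{\sigma}{\sqrt k}$, set $\mathrm{newBin}=1$ and $t_h=t+1$. **Statement.** There are absolute constants $K>0$ and $p\in\mathbb N$ such that the following holds in this setting for all $n\ge2$, $\delta\in(0,1]$, $\sigma\ge0$, $C_n'$, $U$, all $\theta_{1:n}$ in the discrete Sobolev class $\mathcal S(C_n')=\{\theta_{1:n}:\|D\theta_{1:n}\|_2\le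 C_n'\}$ with $|\theta_1|\le U$, and all such noise variables. If ARROWS is run with $\beta=24+\frac{8\log(8/\delta)}{\log n}$, then with probability at least $1-\delta$ its dynamic regret satisfies $$R_n\le K\,\bigl(\log(n/\delta)\bigr)^p\,\Bigl(n^{2/3}[C_n']^{2/3}\sigma^{4/3}+U^2+[C_n']^2+\sigma^2\Bigr),$$ that is, $R_n=\tilde O\bigl(n^{2/3}[C_n']^{2/3}\sigma^{4/3}+U^2+[C_n']^2+\sigma^2\bigr)$, where $\tilde O$ hides factors polylogarithmic in $n$ and $1/\delta$. -/

import Mathlib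

noncomputable section

namespace Arrows

/-- The discrete difference `Dθ = [θ₂ - θ₁, …, θₙ - θₙ₋₁]` of `θ₁, …, θₙ`, as a vector of `ℝⁿ⁻¹`
with the Euclidean norm. Sequences are indexed from `1`; only `θ 1, …, θ n` matter. -/
def discreteDiff (n : ℕ) (θ : ℕ → ℝ) : EuclideanSpace ℝ (Fin (n - 1)) :=
  WithLp.toLp 2 fun i => θ ((i : ℕ) + 2) - θ ((i : ℕ) + 1)

/-- The discrete Sobolev class `{θ : ‖Dθ‖₂ ≤ C}`. -/
def sobolevClass (n : ℕ) (C : ℝ) : Set (ℕ → ℝ) :=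
  {θ | ‖discreteDiff n θ‖ ≤ C}

/-- The loss at time `t`, `ℓ_t(x) = (x - θ_t)²`. -/
def loss (θ : ℕ → ℝ) (t : ℕ) (x : ℝ) : ℝ := (x - θ t) ^ 2

/-- The dynamic regret of the plays `x₁, …, xₙ` :
`∑ ℓ_t(x_t) - ∑ inf_x ℓ_t(x)`. -/
def dynamicRegret (n : ℕ) (θ x : ℕ → ℝ) : ℝ :=
  ∑ t ∈ Finset.Icc 1 n, loss θ t (x t) - ∑ t ∈ Finset.Icc 1 n, ⨅ z : ℝ, loss θ t z

/-- The average of `y_a, …, y_b`. -/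
def avg (y : ℕ → ℝ) (a b : ℕ) : ℝ :=
  (∑ s ∈ Finset.Icc a b, y s) / ((Finset.Icc a b).card : ℝ)

/-- The base-2 logarithm of the padded length of `y_a, …, y_b`: the least `m` with
`b - a + 1 ≤ 2 ^ m`. -/
def padLog (a b : ℕ) : ℕ := Nat.clog 2 (b + 1 - a)

/-- `pad₀(y_a, …, y_b)`: recentred by the average, then padded by zeros at the end up to
a length which is a power of two. -/
def pad0 (y : ℕ → ℝ) (a b : ℕ) : Fin (2 ^ padLog a b) → ℝ :=
  fun j => if a + (j : ℕ) ≤ b then y (a + (j : ℕ)) - avg y a b else 0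

/-- The orthogonal discrete Haar wavelet transform matrix of size `2 ^ m`. Row `0` is constant.
Row `2 ^ l + i`, where `l < m` and `i < 2 ^ l`, is the wavelet of level `l` and position `i`:
it is supported on the `i`-th of the `2 ^ l` consecutive blocks of length `2 ^ (m - l)`, with
value `-1 / √(2 ^ (m - l))` on the first half and `1 / √(2 ^ (m - l))` on the second half. -/
def haarMatrix (m : ℕ) : Matrix (Fin (2 ^ m)) (Fin (2 ^ m)) ℝ :=
  Matrix.of fun r j =>
    if (r : ℕ) = 0 then 1 / √((2 : ℝ) ^ m)
    else
      let l := Nat.log 2 (r : ℕ)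
      let i := (r : ℕ) - 2 ^ l
      let len := 2 ^ (m - l)
      if (j : ℕ) / len = i then
        if (j : ℕ) % len < len / 2 then -(1 / √(len : ℝ)) else 1 / √(len : ℝ)
      else 0

/-- Scalar soft thresholding at level `lam`. -/
def softThreshold (lam x : ℝ) : ℝ := Real.sign x * max (|x| - lam) 0

/-- The thresholded coefficients `α̂(a:b) = T(H pad₀(y_a, …, y_b))`, where `T` is elementwise soft
thresholding at `σ √(β log n)`. -/
def alphaHat (n : ℕ) (σ β : ℝ) (y : ℕ → ℝ) (a b : ℕ) : Fin (2 ^ padLog a b) → ℝ :=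
  fun r => softThreshold (σ * √(β * Real.log n)) ((haarMatrix (padLog a b)).mulVec (pad0 y a b) r)

/-- The `ℓ¹` norm of the block `α[l]`: the `2 ^ l` coefficients of level `l`, which are those with
(zero-based) index in `[2 ^ l, 2 ^ (l + 1))`. -/
def blockNorm {m : ℕ} (α : Fin (2 ^ m) → ℝ) (l : ℕ) : ℝ :=
  ∑ r ∈ Finset.univ.filter (fun r : Fin (2 ^ m) => 2 ^ l ≤ (r : ℕ) ∧ (r : ℕ) < 2 ^ (l + 1)), |α r|

/-- The restart rule at time `t` in a bin started at time `th`, with padded length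
`k = 2 ^ padLog th t`. -/
def Restart (n : ℕ) (σ β : ℝ) (y : ℕ → ℝ) (th t : ℕ) : Prop :=
  1 / √((2 : ℝ) ^ padLog th t) *
      ∑ l ∈ Finset.range (padLog th t),
        (2 : ℝ) ^ ((l : ℝ) / 2) * blockNorm (alphaHat n σ β y th t) l
    > σ / √((2 : ℝ) ^ padLog th t)

/-- The variables of the policy: the start `th` of the current bin, and the flag `newBin`. -/
structure State where
  th : ℕ
  newBin : Bool

open Classical in
/-- The variables of the policy at the end of round `t` (for `t = 0`: after the initialization). -/
def state (n : ℕ) (σ β : ℝ) (y : ℕ → ℝ) : ℕ → State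
  | 0 => ⟨1, true⟩
  | t + 1 =>
    if Restart n σ β y (state n σ β y t).th (t + 1) then ⟨t + 2, true⟩
    else ⟨(state n σ β y t).th, false⟩

/-- The prediction `x_t` of the policy in round `t ≥ 1`. It depends only on
`y 0, …, y (t - 1)`, where `y 0` has to be `0`. -/
def forecast (n : ℕ) (σ β : ℝ) (y : ℕ → ℝ) (t : ℕ) : ℝ :=
  if (state n σ β y (t - 1)).newBin then y (t - 1)
  else avg y (state n σ β y (t - 1)).th (t - 1)

/-- The feedback `y_t = θ_t + z_t` for `t ≥ 1`, with `y_0 = 0`. -/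
def feedback (θ z : ℕ → ℝ) (t : ℕ) : ℝ := if t = 0 then 0 else θ t + z t

end Arrows

end

/-! The argument is deterministic on the event `SmallNoise`: with `lam = σ √(β log n)`, every Haar
coefficient of the recentred noise on every interval is at most `lam`, and so is every average times
the root of its length. A union bound over fewer than `3 n ^ 3` subgaussian linear forms shows that
this event has probability at least `1 - δ` (`measureReal_not_smallNoise_le`, `six_mul_exp_le`).

For a bin of length `L` and squared variation `V`, put `D = L ^ 2 * V`. The restart rule cuts both
ways. No restart: all signal coefficients are at most `3 lam`. This and the total variation give two
bounds for the energy of a level; the first times the square of the second no longer depends on the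
level, so each level has energy `O((lam ^ 4 * D)^{1/3})`. By Parseval this bounds the squared
deviation from the bin average (`sqDev_le_of_not_restart`), hence the error of the running averages
up to a noise term `lam ^ 2 log n` and one increment (`sum_sq_sub_avg_add_le`). Restart: soft
thresholding has removed the noise, so the signal itself must vary, `σ ^ 2 ≲ D` up to logarithms
(`sq_le_of_restart`). Multiplying by `σ ^ 4` and taking cube roots, the noise term of a completed
bin is also `O((σ ^ 4 * D)^{1/3})` up to logarithms (`sq_threshold_le_of_restart`), and the bins
need not be counted.

Hölder's inequality (`cbrt_sq_mul_add_le`) adds the terms `D^{1/3}` of the bins up to that of the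
whole horizon, `(n ^ 2 C ^ 2)^{1/3}`. Only the last, open bin pays its noise term separately. The
first prediction of each bin costs noise and one increment; with `θ 0 = 0` these increments include
`θ 1 ^ 2 ≤ U ^ 2`. -/

noncomputable section

namespace Arrows

open Finset

/-! ### The Haar transform -/

/-- The entries of the Haar matrix, indexed by natural numbers. -/
def haarEntry (m r j : ℕ) : ℝ :=
  if r = 0 then 1 / √((2 : ℝ) ^ m)
  else
    let l := Nat.log 2 r
    let i := r - 2 ^ l
    let len := 2 ^ (m - l)
    if j / len = i then
      if j % len < len / 2 then -(1 / √(len : ℝ)) else 1 / √(len : ℝ)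
    else 0

/-- The Haar coefficients of the first `2 ^ m` terms of a sequence. -/
def haarCoeff (m : ℕ) (u : ℕ → ℝ) (r : ℕ) : ℝ :=
  ∑ j ∈ range (2 ^ m), haarEntry m r j * u j

/-- `pad0`, as a sequence. -/
def padded (y : ℕ → ℝ) (a b j : ℕ) : ℝ := if a + j ≤ b then y (a + j) - avg y a b else 0

lemma mulVec_pad0 (y : ℕ → ℝ) (a b : ℕ) (r : Fin (2 ^ padLog a b)) :
    (haarMatrix (padLog a b)).mulVec (pad0 y a b) r
      = haarCoeff (padLog a b) (padded y a b) r := by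
  unfold haarCoeff
  rw [← Fin.sum_univ_eq_sum_range
    (fun j => haarEntry (padLog a b) r j * padded y a b j) (2 ^ padLog a b)]
  rfl

/-- The sum of a sequence over the `i`-th block of length `w`. -/
def blockSum (u : ℕ → ℝ) (w i : ℕ) : ℝ := ∑ j ∈ Ico (i * w) ((i + 1) * w), u j

lemma blockSum_double (u : ℕ → ℝ) (h i : ℕ) :
    blockSum u (2 * h) i = blockSum u h (2 * i) + blockSum u h (2 * i + 1) := by
  unfold blockSum
  have e1 : i * (2 * h) = 2 * i * h := by ring
  have e2 : (i + 1) * (2 * h) = (2 * i + 1 + 1) * h := by ring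
  rw [e1, e2, sum_Ico_consecutive] <;> nlinarith

lemma log_two_pow_add {l i : ℕ} (hi : i < 2 ^ l) : Nat.log 2 (2 ^ l + i) = l := by
  have hpos : 0 < 2 ^ l := by positivity
  rw [Nat.log_eq_iff (.inr ⟨one_lt_two, by omega⟩), pow_succ]
  omega

/-- A difference of two indicators turns coefficients into differences of block sums; the half
length `h` replaces a division. -/
lemma haarEntry_wavelet {m l i h : ℕ} (hi : i < 2 ^ l) (hh : 2 ^ (m - l) = 2 * h) (j : ℕ) :
    haarEntry m (2 ^ l + i) j
      = (if j ∈ Ico ((2 * i + 1) * h) ((2 * i + 1 + 1) * h) then 1 / √((2 * h : ℕ) : ℝ) else 0)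
        - (if j ∈ Ico (2 * i * h) ((2 * i + 1) * h) then 1 / √((2 * h : ℕ) : ℝ) else 0) := by
  have hpos : 0 < 2 * h := hh ▸ by positivity
  have hne : 2 ^ l + i ≠ 0 := by have : 0 < 2 ^ l := by positivity
                                 omega
  simp only [haarEntry, hne, if_false, log_two_pow_add hi, hh, Nat.add_sub_cancel_left, mem_Ico]
  have hdm := Nat.div_add_mod j (2 * h)
  have hlt := Nat.mod_lt j hpos
  have hhalf : 2 * h / 2 = h := by omega
  rw [hhalf]
  generalize j / (2 * h) = q at *
  generalize j % (2 * h) = s at *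
  by_cases hq : q = i
  · subst hq
    have e0 : 2 * h * q = 2 * q * h := by ring
    have e1 : (2 * q + 1) * h = 2 * q * h + h := by ring
    have e2 : (2 * q + 1 + 1) * h = 2 * q * h + 2 * h := by ring
    rw [e1, e2, if_pos rfl]
    rw [e0] at hdm
    by_cases hs : s < h
    · rw [if_pos hs, if_neg (by omega), if_pos (by omega)]; ring
    · rw [if_neg hs, if_pos (by omega), if_neg (by omega)]; ring
  · rw [if_neg hq]
    have e1 : (2 * i + 1) * h = 2 * h * i + h := by ring
    have e2 : (2 * i + 1 + 1) * h = 2 * h * i + 2 * h := by ring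
    have e3 : 2 * i * h = 2 * h * i := by ring
    rw [e1, e2, e3]
    rcases Nat.lt_or_gt_of_ne hq with hlt' | hgt
    · have : 2 * h * (q + 1) ≤ 2 * h * i := Nat.mul_le_mul_left _ hlt'
      rw [mul_add] at this
      rw [if_neg (by omega), if_neg (by omega)]; ring
    · have : 2 * h * (i + 1) ≤ 2 * h * q := Nat.mul_le_mul_left _ hgt
      rw [mul_add] at this
      rw [if_neg (by omega), if_neg (by omega)]; ring

lemma block_bound {m l i h k : ℕ} (hl : l ≤ m) (hh : 2 ^ (m - l) = 2 * h) (hk : k ≤ 2 * i + 2)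
    (hi : i < 2 ^ l) : k * h ≤ 2 ^ m := by
  have : 2 ^ m = 2 ^ l * (2 * h) := by rw [← hh, ← pow_add]; congr 1; omega
  rw [this]
  calc k * h ≤ (2 * i + 2) * h := Nat.mul_le_mul_right _ hk
    _ = (i + 1) * (2 * h) := by ring
    _ ≤ _ := Nat.mul_le_mul_right _ hi

lemma sum_range_ite_Ico {N p q : ℕ} (hq : q ≤ N) (f : ℕ → ℝ) :
    ∑ j ∈ range N, (if j ∈ Ico p q then f j else 0) = ∑ j ∈ Ico p q, f j := by
  rw [← sum_filter]
  refine sum_congr ?_ fun _ _ => rfl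
  ext j; simp only [mem_filter, mem_range, mem_Ico]; omega

lemma haarCoeff_wavelet {m l i h : ℕ} (hl : l ≤ m) (hi : i < 2 ^ l) (hh : 2 ^ (m - l) = 2 * h)
    (u : ℕ → ℝ) :
    haarCoeff m u (2 ^ l + i)
      = (blockSum u h (2 * i + 1) - blockSum u h (2 * i)) / √((2 * h : ℕ) : ℝ) := by
  unfold haarCoeff
  simp only [haarEntry_wavelet hi hh, sub_mul, ite_mul, zero_mul, sum_sub_distrib]
  rw [sum_range_ite_Ico (block_bound hl hh (by omega) hi),
    sum_range_ite_Ico (block_bound hl hh (by omega) hi), ← mul_sum, ← mul_sum]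
  unfold blockSum
  ring

/-- Keeps the variance proxy of a noise coefficient at `σ ^ 2`. -/
lemma sum_haarEntry_sq_le {m r : ℕ} (hr : r < 2 ^ m) :
    ∑ j ∈ range (2 ^ m), haarEntry m r j ^ 2 ≤ 1 := by
  rcases Nat.eq_zero_or_pos r with rfl | hpos
  · simp only [haarEntry, if_true, sum_const, card_range, nsmul_eq_mul]
    rw [div_pow, one_pow, Real.sq_sqrt (by positivity)]
    push_cast
    rw [mul_one_div_cancel (by positivity)]
  · obtain ⟨l, i, hi, rfl⟩ : ∃ l i, i < 2 ^ l ∧ r = 2 ^ l + i := by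
      refine ⟨Nat.log 2 r, r - 2 ^ Nat.log 2 r, ?_, ?_⟩
      · have := Nat.lt_pow_succ_log_self (b := 2) (by norm_num) r
        rw [pow_succ] at this; omega
      · have := Nat.pow_log_le_self 2 hpos.ne'
        omega
    have hl : l < m := (Nat.pow_lt_pow_iff_right (a := 2) (by norm_num)).1 (by omega)
    have hh : 2 ^ (m - l) = 2 * 2 ^ (m - l - 1) := by
      rw [← pow_succ']; congr 1; omega
    set h := 2 ^ (m - l - 1) with hdef
    have hhpos : 0 < h := by positivity
    have key : ∀ j, haarEntry m (2 ^ l + i) j ^ 2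
        = (if j ∈ Ico (2 * i * h) ((2 * i + 1 + 1) * h) then (1 / ((2 * h : ℕ) : ℝ)) else 0) := by
      intro j
      rw [haarEntry_wavelet hi hh]
      have e1 : (2 * i + 1) * h = 2 * i * h + h := by ring
      have e2 : (2 * i + 1 + 1) * h = 2 * i * h + 2 * h := by ring
      have hs : (1 / √((2 * h : ℕ) : ℝ)) ^ 2 = 1 / ((2 * h : ℕ) : ℝ) := by
        rw [div_pow, one_pow, Real.sq_sqrt (by positivity)]
      rw [e1, e2]
      simp only [mem_Ico]
      split_ifs <;> first | omega | rw [sub_zero, hs] | rw [zero_sub, neg_sq, hs] | simp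
    simp only [key]
    rw [sum_range_ite_Ico (block_bound hl.le hh (by omega) hi), sum_const, Nat.card_Ico,
      nsmul_eq_mul]
    have : (2 * i + 1 + 1) * h - 2 * i * h = 2 * h := by
      have e2 : (2 * i + 1 + 1) * h = 2 * i * h + 2 * h := by ring
      omega
    rw [this, mul_one_div_cancel (by positivity)]

lemma sum_range_two_mul (f : ℕ → ℝ) (N : ℕ) :
    ∑ i ∈ range (2 * N), f i = ∑ i ∈ range N, (f (2 * i) + f (2 * i + 1)) := by
  induction N with
  | zero => simp
  | succ N ih => rw [sum_range_succ, ← ih, mul_add, mul_one, sum_range_succ, sum_range_succ]; ring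

/-- The parallelogram identity in each pair of sibling blocks: one level of Parseval. -/
lemma blockEnergy_split (u : ℕ → ℝ) {h : ℕ} (hh : 0 < h) (N : ℕ) :
    ∑ i ∈ range (2 * N), blockSum u h i ^ 2 / h
      = ∑ i ∈ range N, blockSum u (2 * h) i ^ 2 / (2 * h : ℕ)
        + ∑ i ∈ range N,
          ((blockSum u h (2 * i + 1) - blockSum u h (2 * i)) / √((2 * h : ℕ) : ℝ)) ^ 2 := by
  rw [sum_range_two_mul, ← sum_add_distrib]
  refine sum_congr rfl fun i _ => ?_
  rw [blockSum_double, div_pow, Real.sq_sqrt (by positivity)]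
  push_cast
  field_simp
  ring

/-- Parseval's identity. -/
lemma sum_sq_eq_sum_haarCoeff_sq (m : ℕ) (u : ℕ → ℝ) :
    ∑ j ∈ range (2 ^ m), u j ^ 2
      = (∑ j ∈ range (2 ^ m), u j) ^ 2 / 2 ^ m
        + ∑ l ∈ range m, ∑ i ∈ range (2 ^ l), haarCoeff m u (2 ^ l + i) ^ 2 := by
  -- The energy of the block averages grows by one level of coefficients per refinement; at `l = m`
  -- the blocks are single points.
  have key : ∀ l ≤ m, ∑ i ∈ range (2 ^ l), blockSum u (2 ^ (m - l)) i ^ 2 / (2 ^ (m - l) : ℕ)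
      = (∑ j ∈ range (2 ^ m), u j) ^ 2 / 2 ^ m
        + ∑ l ∈ range l, ∑ i ∈ range (2 ^ l), haarCoeff m u (2 ^ l + i) ^ 2 := by
    intro l
    induction l with
    | zero => intro _; simp [blockSum]
    | succ l ih =>
      intro hl
      have hh : 2 ^ (m - l) = 2 * 2 ^ (m - (l + 1)) := by
        rw [← pow_succ']; congr 1; omega
      rw [pow_succ', blockEnergy_split u (by positivity), ← hh, ih (by omega), sum_range_succ,
        add_assoc]
      congr 2
      refine sum_congr rfl fun i hi => ?_
      rw [haarCoeff_wavelet (by omega) (mem_range.1 hi) hh, ← hh]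
  have := key m le_rfl
  rw [← this]
  simp [blockSum]

lemma abs_sub_le_sum_Ico (u : ℕ → ℝ) {p q : ℕ} (h : p ≤ q) :
    |u q - u p| ≤ ∑ j ∈ Ico p q, |u (j + 1) - u j| := by
  rw [← sum_Ico_sub u h]
  exact abs_sum_le_sum_abs _ _

lemma sum_blocks (f : ℕ → ℝ) (w N : ℕ) :
    ∑ i ∈ range N, ∑ j ∈ Ico (i * w) ((i + 1) * w), f j = ∑ j ∈ range (N * w), f j := by
  induction N with
  | zero => simp
  | succ N ih =>
    rw [sum_range_succ, ih, sum_range_add_sum_Ico]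
    nlinarith

/-- Each entry of the left half is paired with the one `h` places later, and their difference is at
most the variation over the block. The increment leaving the block is counted too, so that the
blocks tile the range. -/
lemma abs_haarCoeff_le {m l i : ℕ} (hl : l < m) (hi : i < 2 ^ l) (u : ℕ → ℝ) :
    |haarCoeff m u (2 ^ l + i)| ≤ √((2 : ℝ) ^ (m - l)) *
      ∑ j ∈ Ico (i * 2 ^ (m - l)) ((i + 1) * 2 ^ (m - l)), |u (j + 1) - u j| := by
  have hh : 2 ^ (m - l) = 2 * 2 ^ (m - l - 1) := by
    rw [← pow_succ']; congr 1; omega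
  have hw : ((2 : ℝ) ^ (m - l)) = ((2 ^ (m - l) : ℕ) : ℝ) := by push_cast; rfl
  rw [haarCoeff_wavelet hl.le hi hh, hw, hh]
  generalize hdef : 2 ^ (m - l - 1) = h
  have hpos : 0 < h := hdef ▸ by positivity
  set v := ∑ j ∈ Ico (i * (2 * h)) ((i + 1) * (2 * h)), |u (j + 1) - u j|
  have e0 : i * (2 * h) = 2 * i * h := by ring
  have e1 : (2 * i + 1) * h = 2 * i * h + h := by ring
  have e2 : (2 * i + 1 + 1) * h = 2 * i * h + h + h := by ring
  have e3 : (i + 1) * (2 * h) = 2 * i * h + 2 * h := by ring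
  have hdiff : |blockSum u h (2 * i + 1) - blockSum u h (2 * i)| ≤ h * v := by
    unfold blockSum
    rw [e1, e2, ← sum_Ico_add' u (2 * i * h) (2 * i * h + h) h, ← sum_sub_distrib]
    calc _ ≤ ∑ j ∈ Ico (2 * i * h) (2 * i * h + h), |u (j + h) - u j| := abs_sum_le_sum_abs _ _
      _ ≤ ∑ j ∈ Ico (2 * i * h) (2 * i * h + h), v := by
        refine sum_le_sum fun j hj => ?_
        rw [mem_Ico] at hj
        refine (abs_sub_le_sum_Ico u (by omega)).trans ?_
        refine sum_le_sum_of_subset_of_nonneg ?_ fun _ _ _ => abs_nonneg _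
        rw [e0, e3]
        exact Ico_subset_Ico (by omega) (by omega)
      _ = h * v := by simp
  have hv : 0 ≤ v := sum_nonneg fun _ _ => abs_nonneg _
  rw [abs_div, abs_of_nonneg (Real.sqrt_nonneg _), div_le_iff₀ (by positivity), mul_right_comm,
    Real.mul_self_sqrt (by positivity)]
  refine hdiff.trans (mul_le_mul_of_nonneg_right ?_ hv)
  push_cast
  have : (0 : ℝ) < h := by exact_mod_cast hpos
  linarith

/-- Level sums of absolute Haar coefficients are controlled by the total variation. -/
lemma sum_abs_haarCoeff_le {m l : ℕ} (hl : l < m) (u : ℕ → ℝ) :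
    ∑ i ∈ range (2 ^ l), |haarCoeff m u (2 ^ l + i)|
      ≤ √((2 : ℝ) ^ (m - l)) * ∑ j ∈ range (2 ^ m), |u (j + 1) - u j| := by
  have e : 2 ^ m = 2 ^ l * 2 ^ (m - l) := by rw [← pow_add]; congr 1; omega
  rw [e, ← sum_blocks, mul_sum]
  exact sum_le_sum fun i hi => abs_haarCoeff_le hl (mem_range.1 hi) u

lemma blockNorm_eq {m l : ℕ} (hl : l < m) (A : ℕ → ℝ) :
    blockNorm (m := m) (fun r => A r) l = ∑ i ∈ range (2 ^ l), |A (2 ^ l + i)| := by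
  unfold blockNorm
  rw [sum_filter, Fin.sum_univ_eq_sum_range
    (fun r => if 2 ^ l ≤ r ∧ r < 2 ^ (l + 1) then |A r| else 0)]
  have hle : 2 ^ (l + 1) ≤ 2 ^ m := Nat.pow_le_pow_right (by norm_num) hl
  have := sum_range_ite_Ico (p := 2 ^ l) hle fun r => |A r|
  simp only [mem_Ico] at this
  rw [this, sum_Ico_eq_sum_range]
  congr 2
  rw [pow_succ]; omega

end Arrows

namespace Arrows

open Finset

/-! ### Cube roots -/

/-- The real cube root. -/
def cbrt (x : ℝ) : ℝ := x ^ (1 / 3 : ℝ)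

lemma cbrt_nonneg {x : ℝ} (hx : 0 ≤ x) : 0 ≤ cbrt x := Real.rpow_nonneg hx _

lemma cbrt_pow_three {x : ℝ} (hx : 0 ≤ x) : cbrt x ^ 3 = x := by
  unfold cbrt
  rw [← Real.rpow_natCast, ← Real.rpow_mul hx]
  norm_num

lemma cbrt_le_cbrt {x y : ℝ} (hx : 0 ≤ x) (h : x ≤ y) : cbrt x ≤ cbrt y :=
  Real.rpow_le_rpow hx h (by norm_num)

lemma cbrt_mul {x y : ℝ} (hx : 0 ≤ x) (hy : 0 ≤ y) : cbrt (x * y) = cbrt x * cbrt y :=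
  Real.mul_rpow hx hy

lemma le_of_pow_three_le {x y : ℝ} (hy : 0 ≤ y) (h : x ^ 3 ≤ y ^ 3) : x ≤ y :=
  le_of_pow_le_pow_left₀ (by norm_num) hy h

lemma cbrt_le {x y : ℝ} (hx : 0 ≤ x) (hy : 0 ≤ y) (h : x ≤ y ^ 3) : cbrt x ≤ y :=
  le_of_pow_three_le hy (by rwa [cbrt_pow_three hx])

/-- Hölder with exponents `3/2` and `3`, in variables that are already cube roots: normalise by `P`
and `Q`, then apply Young's inequality to each term. -/
lemma sq_mul_add_sq_mul_pow_three_le {a b c d : ℝ} (ha : 0 ≤ a) (hb : 0 ≤ b) (hc : 0 ≤ c)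
    (hd : 0 ≤ d) {P Q : ℝ} (hP : 0 ≤ P) (hQ : 0 ≤ Q) (hPe : P ^ 3 = a ^ 3 + b ^ 3)
    (hQe : Q ^ 3 = c ^ 3 + d ^ 3) : a ^ 2 * c + b ^ 2 * d ≤ P ^ 2 * Q := by
  have young : ∀ s w : ℝ, 0 ≤ s → 0 ≤ w → 3 * (s ^ 2 * w) ≤ 2 * s ^ 3 + w ^ 3 := by
    intro s w hs hw
    nlinarith [mul_nonneg (sq_nonneg (s - w)) (by positivity : 0 ≤ 2 * s + w)]
  rcases hP.eq_or_lt with rfl | hP0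
  · have h1 : a ^ 3 = 0 := by nlinarith [pow_nonneg ha 3, pow_nonneg hb 3]
    have h2 : b ^ 3 = 0 := by nlinarith [pow_nonneg ha 3, pow_nonneg hb 3]
    rw [pow_eq_zero_iff (by norm_num)] at h1 h2
    simp [h1, h2]
  rcases hQ.eq_or_lt with rfl | hQ0
  · have h1 : c ^ 3 = 0 := by nlinarith [pow_nonneg hc 3, pow_nonneg hd 3]
    have h2 : d ^ 3 = 0 := by nlinarith [pow_nonneg hc 3, pow_nonneg hd 3]
    rw [pow_eq_zero_iff (by norm_num)] at h1 h2
    simp [h1, h2]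
  have y1 := young (a / P) (c / Q) (by positivity) (by positivity)
  have y2 := young (b / P) (d / Q) (by positivity) (by positivity)
  have e1 : (a / P) ^ 3 + (b / P) ^ 3 = 1 := by
    rw [div_pow, div_pow, ← add_div, ← hPe, div_self (by positivity)]
  have e2 : (c / Q) ^ 3 + (d / Q) ^ 3 = 1 := by
    rw [div_pow, div_pow, ← add_div, ← hQe, div_self (by positivity)]
  have h1 : (a / P) ^ 2 * (c / Q) + (b / P) ^ 2 * (d / Q) ≤ 1 := by linarith
  have e3 : (a / P) ^ 2 * (c / Q) + (b / P) ^ 2 * (d / Q)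
      = (a ^ 2 * c + b ^ 2 * d) / (P ^ 2 * Q) := by field_simp
  rwa [e3, div_le_one (by positivity)] at h1

/-- Hölder's inequality for two terms: `(x, y) ↦ (x² y)^{1/3}` is superadditive. -/
lemma cbrt_sq_mul_add_le {x y x' y' : ℝ} (hx : 0 ≤ x) (hy : 0 ≤ y) (hx' : 0 ≤ x')
    (hy' : 0 ≤ y') :
    cbrt (x ^ 2 * y) + cbrt (x' ^ 2 * y') ≤ cbrt ((x + x') ^ 2 * (y + y')) := by
  have e : ∀ {u v : ℝ}, 0 ≤ u → 0 ≤ v → cbrt (u ^ 2 * v) = cbrt u ^ 2 * cbrt v := by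
    intro u v hu hv
    rw [cbrt_mul (by positivity) hv, sq u, cbrt_mul hu hu, sq]
  rw [e hx hy, e hx' hy', e (by positivity) (by positivity)]
  refine sq_mul_add_sq_mul_pow_three_le (cbrt_nonneg hx) (cbrt_nonneg hx') (cbrt_nonneg hy)
    (cbrt_nonneg hy') (cbrt_nonneg (by positivity)) (cbrt_nonneg (by positivity)) ?_ ?_
  · rw [cbrt_pow_three hx, cbrt_pow_three hx', cbrt_pow_three (by positivity)]
  · rw [cbrt_pow_three hy, cbrt_pow_three hy', cbrt_pow_three (by positivity)]

/-! ### Soft thresholding -/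

lemma abs_softThreshold {lam : ℝ} (hlam : 0 ≤ lam) (x : ℝ) :
    |softThreshold lam x| = max (|x| - lam) 0 := by
  unfold softThreshold
  rw [abs_mul, abs_of_nonneg (le_max_right (|x| - lam) 0)]
  rcases lt_trichotomy x 0 with h | rfl | h
  · simp [Real.sign_of_neg h]
  · simp [hlam]
  · simp [Real.sign_of_pos h]

/-- Shrinking by `lam` undoes any noise of that size, so what survives is due to the signal. -/
lemma abs_softThreshold_add_le {lam x e : ℝ} (he : |e| ≤ lam) :
    |softThreshold lam (x + e)| ≤ |x| := by
  rw [abs_softThreshold ((abs_nonneg e).trans he)]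
  have := abs_add_le x e
  exact max_le (by linarith) (abs_nonneg x)

lemma abs_le_abs_softThreshold_add {lam x e : ℝ} (he : |e| ≤ lam) :
    |x| ≤ |softThreshold lam (x + e)| + 2 * lam := by
  rw [abs_softThreshold ((abs_nonneg e).trans he)]
  have h1 : |x| ≤ |x + e| + |e| := by simpa using abs_sub (x + e) e
  have := le_max_left (|x + e| - lam) 0
  linarith

/-! ### Averages and variations -/

lemma avg_add (θ z : ℕ → ℝ) (a b : ℕ) :
    avg (fun t => θ t + z t) a b = avg θ a b + avg z a b := by
  simp only [avg, sum_add_distrib, add_div]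

lemma padded_add (θ z : ℕ → ℝ) (a b j : ℕ) :
    padded (fun t => θ t + z t) a b j = padded θ a b j + padded z a b j := by
  simp only [padded, avg_add]
  split_ifs <;> ring

lemma haarCoeff_padded_add (m : ℕ) (θ z : ℕ → ℝ) (a b r : ℕ) :
    haarCoeff m (padded (fun t => θ t + z t) a b) r
      = haarCoeff m (padded θ a b) r + haarCoeff m (padded z a b) r := by
  simp only [haarCoeff, padded_add, mul_add, sum_add_distrib]

/-- The sum of the squared increments of a sequence between times `a` and `b`. -/
def sqVar (θ : ℕ → ℝ) (a b : ℕ) : ℝ := ∑ s ∈ Ico a b, (θ (s + 1) - θ s) ^ 2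

lemma sqVar_nonneg (θ : ℕ → ℝ) (a b : ℕ) : 0 ≤ sqVar θ a b :=
  sum_nonneg fun _ _ => sq_nonneg _

lemma sqVar_mono (θ : ℕ → ℝ) {a b a' b' : ℕ} (ha : a' ≤ a) (hb : b ≤ b') :
    sqVar θ a b ≤ sqVar θ a' b' :=
  sum_le_sum_of_subset_of_nonneg (Ico_subset_Ico ha hb) fun _ _ _ => sq_nonneg _

/-- The condition `f 0 = 0` makes the padding invisible. -/
lemma sum_padded_of {m : ℕ} (y : ℕ → ℝ) {a b : ℕ} (hm : b + 1 - a ≤ 2 ^ m)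
    (f : ℝ → ℝ) (hf : f 0 = 0) :
    ∑ j ∈ range (2 ^ m), f (padded y a b j) = ∑ s ∈ Icc a b, f (y s - avg y a b) := by
  have h1 : ∑ j ∈ range (2 ^ m), f (padded y a b j)
      = ∑ j ∈ range (b + 1 - a), f (padded y a b j) := by
    symm
    apply sum_subset (range_subset_range.2 hm)
    intro j _ hj
    rw [mem_range] at hj
    rw [padded, if_neg (by omega), hf]
  have h2 : Icc a b = Ico a (b + 1) := by ext; simp
  rw [h1, h2, sum_Ico_eq_sum_range]
  refine sum_congr rfl fun j hj => ?_
  rw [mem_range] at hj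
  rw [padded, if_pos (by omega)]

lemma sum_sub_avg (y : ℕ → ℝ) {a b : ℕ} (h : a ≤ b) :
    ∑ s ∈ Icc a b, (y s - avg y a b) = 0 := by
  rw [sum_sub_distrib, sum_const, nsmul_eq_mul, avg, Nat.card_Icc, mul_div_cancel₀, sub_self]
  have : b + 1 - a ≠ 0 := by omega
  exact_mod_cast this

lemma abs_sub_avg_le (θ : ℕ → ℝ) {a b : ℕ} (h : a ≤ b) :
    |θ b - avg θ a b| ≤ ∑ s ∈ Ico a b, |θ (s + 1) - θ s| := by
  have hc : (0 : ℝ) < (Icc a b).card := by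
    rw [Nat.card_Icc]
    exact_mod_cast (by omega : 0 < b + 1 - a)
  have e : θ b - avg θ a b = (∑ s ∈ Icc a b, (θ b - θ s)) / (Icc a b).card := by
    rw [avg, sum_sub_distrib, sum_const, nsmul_eq_mul]
    field_simp
  rw [e, abs_div, abs_of_pos hc, div_le_iff₀ hc]
  calc _ ≤ ∑ s ∈ Icc a b, |θ b - θ s| := abs_sum_le_sum_abs _ _
    _ ≤ ∑ s ∈ Icc a b, ∑ s ∈ Ico a b, |θ (s + 1) - θ s| := by
      refine sum_le_sum fun s hs => ?_
      rw [mem_Icc] at hs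
      exact (abs_sub_le_sum_Ico θ hs.2).trans
        (sum_le_sum_of_subset_of_nonneg (Ico_subset_Ico hs.1 le_rfl) fun _ _ _ => abs_nonneg _)
    _ = _ := by rw [sum_const, nsmul_eq_mul, mul_comm]

/-- Recentring before padding keeps the final jump to zero, `|θ b - avg θ a b|`, below the variation
itself; hence the factor 2. -/
lemma sum_abs_padded_sub_le (θ : ℕ → ℝ) {a b m : ℕ} (h : a ≤ b) (hm : b + 1 - a ≤ 2 ^ m) :
    ∑ j ∈ range (2 ^ m), |padded θ a b (j + 1) - padded θ a b j|
      ≤ 2 * ∑ s ∈ Ico a b, |θ (s + 1) - θ s| := by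
  have h1 : ∑ j ∈ range (2 ^ m), |padded θ a b (j + 1) - padded θ a b j|
      = ∑ j ∈ range (b - a + 1), |padded θ a b (j + 1) - padded θ a b j| := by
    symm
    apply sum_subset (range_subset_range.2 (by omega))
    intro j _ hj
    rw [mem_range] at hj
    rw [padded, padded, if_neg (by omega), if_neg (by omega)]
    simp
  have h2 : ∑ j ∈ range (b - a), |padded θ a b (j + 1) - padded θ a b j|
      = ∑ s ∈ Ico a b, |θ (s + 1) - θ s| := by
    rw [sum_Ico_eq_sum_range]
    refine sum_congr rfl fun j hj => ?_
    rw [mem_range] at hj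
    rw [padded, padded, if_pos (by omega), if_pos (by omega)]
    congr 1
    rw [← add_assoc]; ring
  have h3 : |padded θ a b (b - a + 1) - padded θ a b (b - a)| = |θ b - avg θ a b| := by
    rw [padded, padded, if_neg (by omega), if_pos (by omega), zero_sub, abs_neg]
    congr 3; omega
  rw [h1, sum_range_succ, h2, h3]
  linarith [abs_sub_avg_le θ h]

lemma sq_sum_abs_padded_sub_le (θ : ℕ → ℝ) {a b m : ℕ} (h : a ≤ b) (hm : b + 1 - a ≤ 2 ^ m) :
    (∑ j ∈ range (2 ^ m), |padded θ a b (j + 1) - padded θ a b j|) ^ 2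
      ≤ 4 * ((b + 1 - a : ℕ) * sqVar θ a b) := by
  have h1 := pow_le_pow_left₀ (sum_nonneg fun _ _ => abs_nonneg _)
    (sum_abs_padded_sub_le θ h hm) 2
  have h2 := sq_sum_le_card_mul_sum_sq (s := Ico a b) (f := fun s => |θ (s + 1) - θ s|)
  simp only [sq_abs, Nat.card_Ico] at h2
  have h3 : ((b - a : ℕ) : ℝ) ≤ ((b + 1 - a : ℕ) : ℝ) := by exact_mod_cast (by omega)
  have h4 := mul_le_mul_of_nonneg_right h3 (sqVar_nonneg θ a b)
  unfold sqVar at *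
  nlinarith

lemma le_two_pow_padLog (a b : ℕ) : b + 1 - a ≤ 2 ^ padLog a b :=
  Nat.le_pow_clog (by norm_num) _

lemma two_pow_padLog_le {a b : ℕ} (h : a ≤ b) : 2 ^ padLog a b ≤ 2 * (b + 1 - a) := by
  unfold padLog
  rcases (by omega : b + 1 - a = 1 ∨ 1 < b + 1 - a) with h1 | h1
  · simp [h1]
  · have h2 := Nat.pow_pred_clog_lt_self (b := 2) (by norm_num) h1
    have h3 := Nat.clog_pos (b := 2) (by norm_num) h1
    have h4 : 2 ^ Nat.clog 2 (b + 1 - a) = 2 * 2 ^ (Nat.clog 2 (b + 1 - a)).pred := by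
      rw [← pow_succ']; congr 1; simp only [Nat.pred_eq_sub_one]; omega
    omega

lemma padLog_le {a b n : ℕ} (ha : 1 ≤ a) (hb : b ≤ n) : padLog a b ≤ Nat.clog 2 n :=
  Nat.clog_mono_right 2 (by omega)

/-- The squared total variation of the padded vector, times the padded length. -/
lemma two_pow_mul_sq_sum_le (θ : ℕ → ℝ) {a b : ℕ} (h : a ≤ b) :
    (2 : ℝ) ^ padLog a b *
      (∑ j ∈ range (2 ^ padLog a b), |padded θ a b (j + 1) - padded θ a b j|) ^ 2
      ≤ 8 * ((b + 1 - a : ℕ) ^ 2 * sqVar θ a b) := by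
  have h1 := sq_sum_abs_padded_sub_le θ h (le_two_pow_padLog a b)
  have h2 : (2 : ℝ) ^ padLog a b ≤ 2 * (b + 1 - a : ℕ) := by
    exact_mod_cast two_pow_padLog_le h
  calc _ ≤ 2 * ((b + 1 - a : ℕ) : ℝ) * (4 * ((b + 1 - a : ℕ) * sqVar θ a b)) :=
        mul_le_mul h2 h1 (sq_nonneg _) (by positivity)
    _ = _ := by ring

/-! ### The restart rule -/

lemma blockNorm_alphaHat {n : ℕ} {σ β : ℝ} (y : ℕ → ℝ) {a b l : ℕ} (hl : l < padLog a b) :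
    blockNorm (alphaHat n σ β y a b) l
      = ∑ i ∈ range (2 ^ l), |softThreshold (σ * √(β * Real.log n))
          (haarCoeff (padLog a b) (padded y a b) (2 ^ l + i))| := by
  rw [← blockNorm_eq hl fun r => softThreshold (σ * √(β * Real.log n))
          (haarCoeff (padLog a b) (padded y a b) r)]
  congr 1
  funext r
  simp only [alphaHat, mulVec_pad0]

/-- The factor `1 / √k` cancels on both sides. -/
lemma restart_iff {n : ℕ} {σ β : ℝ} (y : ℕ → ℝ) {a b : ℕ} :
    Restart n σ β y a b ↔ σ < ∑ l ∈ range (padLog a b), √((2 : ℝ) ^ l) *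
      ∑ i ∈ range (2 ^ l), |softThreshold (σ * √(β * Real.log n))
          (haarCoeff (padLog a b) (padded y a b) (2 ^ l + i))| := by
  have e : ∑ l ∈ range (padLog a b), (2 : ℝ) ^ ((l : ℝ) / 2) * blockNorm (alphaHat n σ β y a b) l
      = ∑ l ∈ range (padLog a b), √((2 : ℝ) ^ l) *
      ∑ i ∈ range (2 ^ l), |softThreshold (σ * √(β * Real.log n))
          (haarCoeff (padLog a b) (padded y a b) (2 ^ l + i))| := by
    refine sum_congr rfl fun l hl => ?_
    rw [blockNorm_alphaHat y (mem_range.1 hl), Real.sqrt_eq_rpow ((2 : ℝ) ^ l),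
      ← Real.rpow_natCast, ← Real.rpow_mul (by norm_num), mul_one_div]
  have hp : 0 < √((2 : ℝ) ^ padLog a b) := by positivity
  rw [Restart, e, one_div_mul_eq_div, gt_iff_lt, div_lt_div_iff_of_pos_right hp]

lemma level_index_lt {m l i : ℕ} (hl : l < m) (hi : i < 2 ^ l) : 2 ^ l + i < 2 ^ m := by
  have : 2 ^ (l + 1) ≤ 2 ^ m := Nat.pow_le_pow_right (by norm_num) hl
  rw [pow_succ] at this
  omega

/-- A restart certifies that the bin has a large variation. -/
lemma sq_le_of_restart {n : ℕ} {σ β : ℝ} (hσ : 0 ≤ σ) {θ z : ℕ → ℝ} {a b : ℕ} (h : a ≤ b)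
    (hN : ∀ r < 2 ^ padLog a b,
      |haarCoeff (padLog a b) (padded z a b) r| ≤ σ * √(β * Real.log n))
    (hR : Restart n σ β (fun t => θ t + z t) a b) :
    σ ^ 2 ≤ 8 * ((padLog a b : ℝ) ^ 2 * ((b + 1 - a : ℕ) ^ 2 * sqVar θ a b)) := by
  rw [restart_iff] at hR
  set m := padLog a b
  set v := ∑ j ∈ range (2 ^ m), |padded θ a b (j + 1) - padded θ a b j|
  have hle : σ ≤ m * (√((2 : ℝ) ^ m) * v) := by
    refine hR.le.trans ?_
    calc _ ≤ ∑ l ∈ range m, √((2 : ℝ) ^ m) * v := by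
          refine sum_le_sum fun l hl => ?_
          rw [mem_range] at hl
          -- The weight of the level offsets the decay of its coefficients: every level gets the
          -- same bound.
          calc _ ≤ √((2 : ℝ) ^ l) * (√((2 : ℝ) ^ (m - l)) * v) := by
                refine mul_le_mul_of_nonneg_left ?_ (Real.sqrt_nonneg _)
                refine le_trans (sum_le_sum fun i hi => ?_) (sum_abs_haarCoeff_le hl _)
                rw [haarCoeff_padded_add]
                exact abs_softThreshold_add_le (hN _ (level_index_lt hl (mem_range.1 hi)))
            _ = √((2 : ℝ) ^ m) * v := by
                rw [← mul_assoc, ← Real.sqrt_mul (by positivity), ← pow_add]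
                congr 4; omega
      _ = _ := by rw [sum_const, card_range, nsmul_eq_mul]
  have h1 := pow_le_pow_left₀ hσ hle 2
  have h2 := two_pow_mul_sq_sum_le θ h
  rw [mul_pow, mul_pow, Real.sq_sqrt (by positivity)] at h1
  have h3 := mul_le_mul_of_nonneg_left h2 (sq_nonneg (m : ℝ))
  linarith

/-- The sum of squared deviations from the average. -/
def sqDev (θ : ℕ → ℝ) (a b : ℕ) : ℝ := ∑ s ∈ Icc a b, (θ s - avg θ a b) ^ 2

/-- Parseval; the constant coefficient vanishes by recentring. -/
lemma sqDev_eq_sum_haarCoeff (θ : ℕ → ℝ) {a b : ℕ} (h : a ≤ b) :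
    sqDev θ a b = ∑ l ∈ range (padLog a b), ∑ i ∈ range (2 ^ l),
      haarCoeff (padLog a b) (padded θ a b) (2 ^ l + i) ^ 2 := by
  have h1 := sum_sq_eq_sum_haarCoeff_sq (padLog a b) (padded θ a b)
  have h2 := sum_padded_of θ (le_two_pow_padLog a b) (fun x => x) rfl
  have h3 := sum_padded_of θ (le_two_pow_padLog a b) (fun x => x ^ 2) (by norm_num)
  rw [sum_sub_avg θ h] at h2
  rw [h2, h3] at h1
  rw [sqDev, h1]
  simp

/-- Without a restart, the sequence is close to its average on the bin. -/
lemma sqDev_le_of_not_restart {n : ℕ} {σ β : ℝ} {θ z : ℕ → ℝ} {a b : ℕ}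
    (h : a ≤ b)
    (hN : ∀ r < 2 ^ padLog a b,
      |haarCoeff (padLog a b) (padded z a b) r| ≤ σ * √(β * Real.log n))
    (hσ : σ ≤ σ * √(β * Real.log n))
    (hR : ¬ Restart n σ β (fun t => θ t + z t) a b) :
    sqDev θ a b ≤ 9 * padLog a b *
      cbrt ((σ * √(β * Real.log n)) ^ 4 * ((b + 1 - a : ℕ) ^ 2 * sqVar θ a b)) := by
  rw [restart_iff, not_lt] at hR
  rw [sqDev_eq_sum_haarCoeff θ h]
  have h2 := two_pow_mul_sq_sum_le θ h
  set m := padLog a b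
  set lam := σ * √(β * Real.log n)
  set v := ∑ j ∈ range (2 ^ m), |padded θ a b (j + 1) - padded θ a b j|
  set D := ((b + 1 - a : ℕ) : ℝ) ^ 2 * sqVar θ a b
  have hD : 0 ≤ D := mul_nonneg (by positivity) (sqVar_nonneg _ _ _)
  have hlam : 0 ≤ lam := (abs_nonneg _).trans (hN 0 (by positivity))
  -- The weights are at least 1, so each thresholded coefficient is at most `σ ≤ lam`; undoing
  -- threshold and noise costs `2 * lam`.
  have hcoef : ∀ l < m, ∀ i < 2 ^ l, |haarCoeff m (padded θ a b) (2 ^ l + i)| ≤ 3 * lam := by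
    intro l hl i hi
    have h1 := abs_le_abs_softThreshold_add (x := haarCoeff m (padded θ a b) (2 ^ l + i))
      (hN _ (level_index_lt hl hi))
    rw [← haarCoeff_padded_add] at h1
    have h3 : |softThreshold lam
        (haarCoeff m (padded (fun t => θ t + z t) a b) (2 ^ l + i))| ≤ σ := by
      refine le_trans ?_ hR
      have hs : 1 ≤ √((2 : ℝ) ^ l) := Real.one_le_sqrt.2 (one_le_pow₀ (by norm_num))
      have hi' := single_le_sum (f := fun i => |softThreshold lam
        (haarCoeff m (padded (fun t => θ t + z t) a b) (2 ^ l + i))|)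
        (fun _ _ => abs_nonneg _) (mem_range.2 hi)
      have hl' := single_le_sum (f := fun l => √((2 : ℝ) ^ l) * ∑ i ∈ range (2 ^ l),
        |softThreshold lam (haarCoeff m (padded (fun t => θ t + z t) a b) (2 ^ l + i))|)
        (fun _ _ => mul_nonneg (Real.sqrt_nonneg _) (sum_nonneg fun _ _ => abs_nonneg _))
        (mem_range.2 hl)
      refine le_trans (le_trans hi' ?_) hl'
      exact le_mul_of_one_le_left (sum_nonneg fun _ _ => abs_nonneg _) hs
    linarith
  have hlevel : ∀ l ∈ range m, ∑ i ∈ range (2 ^ l), haarCoeff m (padded θ a b) (2 ^ l + i) ^ 2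
      ≤ 9 * cbrt (lam ^ 4 * D) := by
    intro l hl
    rw [mem_range] at hl
    set S := ∑ i ∈ range (2 ^ l), haarCoeff m (padded θ a b) (2 ^ l + i) ^ 2
    have hS : 0 ≤ S := sum_nonneg fun _ _ => sq_nonneg _
    have hS1 : S ≤ 2 ^ l * (9 * lam ^ 2) := by
      calc S ≤ ∑ i ∈ range (2 ^ l), 9 * lam ^ 2 := by
            refine sum_le_sum fun i hi => ?_
            rw [← sq_abs]
            nlinarith [hcoef l hl i (mem_range.1 hi),
              abs_nonneg (haarCoeff m (padded θ a b) (2 ^ l + i))]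
        _ = _ := by simp
    have hS2 : S ≤ 3 * lam * (√((2 : ℝ) ^ (m - l)) * v) := by
      calc S ≤ ∑ i ∈ range (2 ^ l), 3 * lam * |haarCoeff m (padded θ a b) (2 ^ l + i)| := by
            refine sum_le_sum fun i hi => ?_
            rw [← sq_abs, sq]
            exact mul_le_mul_of_nonneg_right (hcoef l hl i (mem_range.1 hi)) (abs_nonneg _)
        _ ≤ _ := by
            rw [← mul_sum]
            exact mul_le_mul_of_nonneg_left (sum_abs_haarCoeff_le hl _) (by positivity)
    have hS2' := pow_le_pow_left₀ hS hS2 2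
    rw [mul_pow (3 * lam), mul_pow √_, Real.sq_sqrt (by positivity)] at hS2'
    -- The number of coefficients bounds one factor `S`, the variation the other two; the powers of
    -- `2 ^ l` cancel. With `h2` the constant is `81 * 8 = 648 ≤ 9 ^ 3`.
    have h4 : S ^ 3 ≤ 81 * (lam ^ 4 * (2 ^ m * v ^ 2)) := by
      calc S ^ 3 = S * S ^ 2 := by ring
        _ ≤ (2 ^ l * (9 * lam ^ 2)) * ((3 * lam) ^ 2 * (2 ^ (m - l) * v ^ 2)) :=
          mul_le_mul hS1 hS2' (by positivity) (by positivity)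
        _ = 81 * (lam ^ 4 * ((2 ^ l * 2 ^ (m - l)) * v ^ 2)) := by ring
        _ = _ := by rw [← pow_add]; congr 5; omega
    apply le_of_pow_three_le (mul_nonneg (by norm_num) (cbrt_nonneg (by positivity)))
    rw [mul_pow, cbrt_pow_three (by positivity)]
    have h5 := mul_le_mul_of_nonneg_left h2 (by positivity : 0 ≤ lam ^ 4)
    have h6 : 0 ≤ lam ^ 4 * D := by positivity
    nlinarith
  refine (sum_le_sum hlevel).trans (le_of_eq ?_)
  rw [sum_const, card_range, nsmul_eq_mul]
  ring

/-! ### Running averages -/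

lemma sqDev_eq (θ : ℕ → ℝ) {a b : ℕ} (h : a ≤ b) :
    sqDev θ a b = ∑ s ∈ Icc a b, θ s ^ 2 - (∑ s ∈ Icc a b, θ s) ^ 2 / (b + 1 - a : ℕ) := by
  have hc : ((b + 1 - a : ℕ) : ℝ) ≠ 0 := by exact_mod_cast (by omega : b + 1 - a ≠ 0)
  unfold sqDev avg
  rw [Nat.card_Icc]
  simp only [sub_sq, sum_add_distrib, sum_sub_distrib, sum_const, Nat.card_Icc, nsmul_eq_mul,
    ← sum_mul, ← mul_sum]
  field_simp
  ring

/-- For length `L` the exact gain is `L / (L + 1)` times the squared prediction error, hence at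
least half of it. -/
lemma sqDev_succ (θ : ℕ → ℝ) {a b : ℕ} (h : a ≤ b) :
    sqDev θ a b + (θ (b + 1) - avg θ a b) ^ 2 / 2 ≤ sqDev θ a (b + 1) := by
  rw [sqDev_eq θ h, sqDev_eq θ (h.trans b.le_succ), avg, Nat.card_Icc,
    sum_Icc_succ_top (by omega), sum_Icc_succ_top (by omega)]
  have hL : b + 1 + 1 - a = b + 1 - a + 1 := by omega
  have hc : (1 : ℝ) ≤ ((b + 1 - a : ℕ) : ℝ) := by exact_mod_cast (by omega : 1 ≤ b + 1 - a)
  rw [hL]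
  push_cast
  generalize ((b + 1 - a : ℕ) : ℝ) = L at *
  generalize ∑ s ∈ Icc a b, θ s = S
  generalize ∑ s ∈ Icc a b, θ s ^ 2 = Q
  generalize θ (b + 1) = x
  have key : Q + x ^ 2 - (S + x) ^ 2 / (L + 1) - (Q - S ^ 2 / L + (x - S / L) ^ 2 / 2)
      = (x - S / L) ^ 2 * ((L - 1) / (2 * (L + 1))) := by
    field_simp
    ring
  have : 0 ≤ (x - S / L) ^ 2 * ((L - 1) / (2 * (L + 1))) :=
    mul_nonneg (sq_nonneg _) (div_nonneg (by linarith) (by linarith))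
  linarith

lemma sum_sq_sub_avg_le (θ : ℕ → ℝ) {a b : ℕ} (h : a ≤ b) :
    ∑ s ∈ Ico a b, (θ (s + 1) - avg θ a s) ^ 2 ≤ 2 * sqDev θ a b := by
  induction b, h using Nat.le_induction with
  | base => simp [sqDev, avg]
  | succ b h ih =>
    rw [sum_Ico_succ_top h]
    linarith [sqDev_succ θ h]

lemma sum_inv_le (a b : ℕ) :
    ∑ s ∈ Ico a b, 1 / ((s + 1 - a : ℕ) : ℝ) ≤ 1 + Real.log (b - a : ℕ) := by
  have := harmonic_le_one_add_log (b - a)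
  rw [harmonic] at this
  push_cast at this
  refine le_trans (le_of_eq ?_) this
  rw [sum_Ico_eq_sum_range]
  refine sum_congr rfl fun j _ => ?_
  have : a + j + 1 - a = j + 1 := by omega
  rw [this, one_div]
  push_cast
  rfl

/-- The error of the running averages of the feedback, in terms of the deviation from the
average of the signal. -/
lemma sum_sq_sub_avg_add_le {θ z : ℕ → ℝ} {a b n : ℕ} {lam : ℝ} (ha : 1 ≤ a) (h : a ≤ b)
    (hb : b < n)
    (hN : ∀ s, a ≤ s → s ≤ n → avg z a s ^ 2 * (s + 1 - a : ℕ) ≤ lam ^ 2) :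
    ∑ s ∈ Ico a (b + 1), (avg (fun t => θ t + z t) a s - θ (s + 1)) ^ 2
      ≤ 8 * sqDev θ a b + 4 * (θ (b + 1) - θ b) ^ 2 + 2 * (lam ^ 2 * (1 + Real.log n)) := by
  have h1 : ∀ s ∈ Ico a (b + 1), (avg (fun t => θ t + z t) a s - θ (s + 1)) ^ 2
      ≤ 2 * (θ (s + 1) - avg θ a s) ^ 2 + 2 * (lam ^ 2 * (1 / ((s + 1 - a : ℕ) : ℝ))) := by
    intro s hs
    rw [mem_Ico] at hs
    have hc : (0 : ℝ) < ((s + 1 - a : ℕ) : ℝ) := by exact_mod_cast (by omega : 0 < s + 1 - a)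
    have h2 : avg z a s ^ 2 ≤ lam ^ 2 * (1 / ((s + 1 - a : ℕ) : ℝ)) := by
      rw [mul_one_div, le_div_iff₀ hc]
      exact hN s hs.1 (by omega)
    rw [avg_add]
    nlinarith [sq_nonneg (θ (s + 1) - avg θ a s + avg z a s)]
  refine (sum_le_sum h1).trans ?_
  -- The target `θ (b + 1)` lies outside the stretch whose deviation is controlled; its term is
  -- split off and compared with `θ b`.
  rw [sum_add_distrib, ← mul_sum, ← mul_sum, ← mul_sum, sum_Ico_succ_top h]
  have h2 := sum_sq_sub_avg_le θ h
  have h3 : (θ b - avg θ a b) ^ 2 ≤ sqDev θ a b :=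
    single_le_sum (f := fun s => (θ s - avg θ a b) ^ 2) (fun _ _ => sq_nonneg _)
      (mem_Icc.2 ⟨h, le_rfl⟩)
  have h4 : (θ (b + 1) - avg θ a b) ^ 2
      ≤ 2 * (θ (b + 1) - θ b) ^ 2 + 2 * (θ b - avg θ a b) ^ 2 := by
    nlinarith [sq_nonneg (θ (b + 1) - θ b - (θ b - avg θ a b))]
  have h5 : ∑ s ∈ Ico a (b + 1), 1 / ((s + 1 - a : ℕ) : ℝ) ≤ 1 + Real.log n := by
    refine (sum_inv_le a (b + 1)).trans ?_
    have hpos : (0 : ℝ) < ((b + 1 - a : ℕ) : ℝ) := by exact_mod_cast (by omega : 0 < b + 1 - a)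
    have hle : ((b + 1 - a : ℕ) : ℝ) ≤ n := by exact_mod_cast (by omega)
    linarith [Real.log_le_log hpos hle]
  have h6 := mul_le_mul_of_nonneg_left h5 (sq_nonneg lam)
  linarith

end Arrows

namespace Arrows

open Finset

/-! ### The regret on the event that the noise is small -/

lemma avg_self (y : ℕ → ℝ) (s : ℕ) : avg y s s = y s := by simp [avg]

lemma dynamicRegret_eq (n : ℕ) (θ x : ℕ → ℝ) :
    dynamicRegret n θ x = ∑ t ∈ Ico 1 (n + 1), (x t - θ t) ^ 2 := by
  have h : ∀ t, ⨅ z : ℝ, loss θ t z = 0 := fun t =>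
    le_antisymm
      ((ciInf_le ⟨0, by rintro _ ⟨z, rfl⟩; exact sq_nonneg _⟩ (θ t)).trans (by simp [loss]))
      (le_ciInf fun z => sq_nonneg _)
  have h2 : Icc 1 n = Ico 1 (n + 1) := by ext; simp
  simp only [dynamicRegret, h, sum_const_zero, sub_zero, h2]
  rfl

/-- The noise, as seen through the Haar transform and through averages, is at most `lam`. -/
structure SmallNoise (n : ℕ) (lam : ℝ) (z : ℕ → ℝ) : Prop where
  haar : ∀ a b, 1 ≤ a → a ≤ b → b ≤ n → ∀ r < 2 ^ padLog a b,
    |haarCoeff (padLog a b) (padded z a b) r| ≤ lam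
  avg : ∀ a b, 1 ≤ a → a ≤ b → b ≤ n → avg z a b ^ 2 * (b + 1 - a : ℕ) ≤ lam ^ 2

/-- The bound for the regret of a bin that depends on the signal. -/
def binBound (σ κ : ℝ) (θ : ℕ → ℝ) (a b : ℕ) : ℝ :=
  κ * (cbrt (σ ^ 4) * cbrt ((b + 1 - a : ℕ) ^ 2 * sqVar θ a b))

section Policy

variable {n : ℕ} {σ β ρ : ℝ} {θ z : ℕ → ℝ}

lemma cbrt_four_mul {x : ℝ} (hρ : 1 ≤ ρ) (hx : 0 ≤ x) :
    cbrt ((σ * √ρ) ^ 4 * x) ≤ ρ * (cbrt (σ ^ 4) * cbrt x) := by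
  have e : (√ρ) ^ 4 = ρ ^ 2 := by
    rw [show (√ρ) ^ 4 = ((√ρ) ^ 2) ^ 2 by ring, Real.sq_sqrt (by linarith)]
  have h4 : 0 ≤ σ ^ 4 := by positivity
  refine cbrt_le (by positivity)
    (mul_nonneg (by linarith) (mul_nonneg (cbrt_nonneg h4) (cbrt_nonneg hx))) ?_
  rw [mul_pow, mul_pow, mul_pow, cbrt_pow_three h4, cbrt_pow_three hx, e]
  have : ρ ^ 2 ≤ ρ ^ 3 := pow_le_pow_right₀ hρ (by norm_num)
  nlinarith [mul_le_mul_of_nonneg_right this (mul_nonneg h4 hx)]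

lemma sqDev_le_of_smallNoise (hσ : 0 ≤ σ) (hρ : 1 ≤ β * Real.log n)
    (hz : SmallNoise n (σ * √(β * Real.log n)) z) {a b : ℕ} (ha : 1 ≤ a) (hab : a ≤ b)
    (hb : b ≤ n) (hR : ¬ Restart n σ β (fun t => θ t + z t) a b) :
    sqDev θ a b ≤ 9 * Nat.clog 2 n * (β * Real.log n) *
      (cbrt (σ ^ 4) * cbrt ((b + 1 - a : ℕ) ^ 2 * sqVar θ a b)) := by
  have hD : 0 ≤ ((b + 1 - a : ℕ) : ℝ) ^ 2 * sqVar θ a b :=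
    mul_nonneg (by positivity) (sqVar_nonneg _ _ _)
  have hs : σ ≤ σ * √(β * Real.log n) := le_mul_of_one_le_right hσ (Real.one_le_sqrt.2 hρ)
  refine (sqDev_le_of_not_restart hab (hz.haar a b ha hab hb) hs hR).trans ?_
  have hm : (padLog a b : ℝ) ≤ Nat.clog 2 n := by exact_mod_cast padLog_le ha hb
  rw [mul_assoc (9 * (Nat.clog 2 n : ℝ))]
  exact mul_le_mul (by linarith) (cbrt_four_mul hρ hD) (cbrt_nonneg (by positivity))
    (by positivity)

/-- A restart pays for the noise of its bin: `σ ^ 6 = σ ^ 4 * σ ^ 2`, with the restart certificate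
for the last factor, followed by a cube root. -/
lemma sq_threshold_le_of_restart (hσ : 0 ≤ σ) (hn : 2 ≤ n) (hρ : 1 ≤ β * Real.log n)
    (hz : SmallNoise n (σ * √(β * Real.log n)) z) {a b : ℕ} (ha : 1 ≤ a) (hab : a ≤ b)
    (hb : b ≤ n) (hR : Restart n σ β (fun t => θ t + z t) a b) :
    (σ * √(β * Real.log n)) ^ 2 ≤ 2 * Nat.clog 2 n * (β * Real.log n) *
      (cbrt (σ ^ 4) * cbrt ((b + 1 - a : ℕ) ^ 2 * sqVar θ a b)) := by
  have h1 := sq_le_of_restart hσ hab (hz.haar a b ha hab hb) hR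
  set D := ((b + 1 - a : ℕ) : ℝ) ^ 2 * sqVar θ a b
  have hD : 0 ≤ D := mul_nonneg (by positivity) (sqVar_nonneg _ _ _)
  have hm : (padLog a b : ℝ) ≤ Nat.clog 2 n := by exact_mod_cast padLog_le ha hb
  have hM : (1 : ℝ) ≤ Nat.clog 2 n := by
    exact_mod_cast Nat.clog_pos (b := 2) (by norm_num) hn
  set M : ℝ := ((Nat.clog 2 n : ℕ) : ℝ)
  have hm3 : (padLog a b : ℝ) ^ 2 ≤ M ^ 3 :=
    (pow_le_pow_left₀ (by positivity) hm 2).trans (pow_le_pow_right₀ hM (by norm_num))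
  have h4 : 0 ≤ σ ^ 4 := by positivity
  have hc : 0 ≤ cbrt (σ ^ 4) * cbrt D := mul_nonneg (cbrt_nonneg h4) (cbrt_nonneg hD)
  have key : σ ^ 2 ≤ 2 * M * (cbrt (σ ^ 4) * cbrt D) := by
    apply le_of_pow_three_le (by positivity)
    rw [mul_pow, mul_pow, mul_pow, cbrt_pow_three h4, cbrt_pow_three hD]
    have h5 : σ ^ 2 ≤ 8 * (M ^ 3 * D) :=
      h1.trans (by linarith [mul_le_mul_of_nonneg_right hm3 hD])
    nlinarith [mul_le_mul_of_nonneg_left h5 h4]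
  rw [mul_pow, Real.sq_sqrt (by linarith)]
  nlinarith [mul_le_mul_of_nonneg_right key (by linarith : 0 ≤ β * Real.log n)]

lemma sqVar_succ_top {a b : ℕ} (h : a ≤ b) :
    sqVar θ a (b + 1) = sqVar θ a b + (θ (b + 1) - θ b) ^ 2 := sum_Ico_succ_top h _

/-- The errors in a bin `a, …, b` all of whose rounds but possibly the last do not restart. -/
lemma sum_bin_le (hσ : 0 ≤ σ) (hρ : 1 ≤ β * Real.log n)
    (hz0 : z 0 = 0) (hz : SmallNoise n (σ * √(β * Real.log n)) z) {a b : ℕ} (ha : 1 ≤ a)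
    (hab : a ≤ b) (hb : b ≤ n)
    (hR : ∀ s, a ≤ s → s < b → ¬ Restart n σ β (fun t => θ t + z t) a s)
    {x : ℕ → ℝ} (hx0 : x a = θ (a - 1) + z (a - 1))
    (hx : ∀ s, a ≤ s → s < b → x (s + 1) = avg (fun t => θ t + z t) a s) :
    ∑ s ∈ Ico a (b + 1), (x s - θ s) ^ 2
      ≤ 6 * sqVar θ (a - 1) b + binBound σ (72 * Nat.clog 2 n * (β * Real.log n)) θ a b
        + (σ * √(β * Real.log n)) ^ 2 * (4 + 2 * Real.log n) := by
  set lam := σ * √(β * Real.log n)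
  have hlog : 0 ≤ Real.log n := Real.log_natCast_nonneg n
  have hfirst : (x a - θ a) ^ 2 ≤ 2 * lam ^ 2 + 2 * (θ a - θ (a - 1)) ^ 2 := by
    have h1 : z (a - 1) ^ 2 ≤ lam ^ 2 := by
      rcases (by omega : a = 1 ∨ 1 ≤ a - 1) with rfl | h1
      · simp [hz0, sq_nonneg]
      · have := hz.avg (a - 1) (a - 1) h1 le_rfl (by omega)
        rw [avg_self, Nat.add_sub_cancel_left] at this
        simpa using this
    rw [hx0]
    nlinarith [sq_nonneg (z (a - 1) + (θ a - θ (a - 1)))]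
  have hbin : 0 ≤ binBound σ (72 * Nat.clog 2 n * (β * Real.log n)) θ a b := by
    unfold binBound
    exact mul_nonneg (by positivity) (mul_nonneg (cbrt_nonneg (by positivity))
      (cbrt_nonneg (mul_nonneg (by positivity) (sqVar_nonneg _ _ _))))
  have hlamlog : 0 ≤ lam ^ 2 * Real.log n := by positivity
  obtain ⟨c, rfl⟩ : ∃ c, a = c + 1 := ⟨a - 1, by omega⟩
  simp only [Nat.add_sub_cancel] at *
  rw [sum_eq_sum_Ico_succ_bot (by omega)]
  rcases hab.eq_or_lt with rfl | hlt
  · rw [Ico_self, sum_empty, sqVar_succ_top le_rfl]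
    have : 0 ≤ sqVar θ c c := sqVar_nonneg _ _ _
    nlinarith [sq_nonneg lam, sq_nonneg (θ (c + 1) - θ c)]
  -- Round `b` may restart, so the deviation is controlled only up to `d = b - 1`.
  · obtain ⟨d, rfl⟩ : ∃ d, b = d + 1 := ⟨b - 1, by omega⟩
    have hcd : c + 1 ≤ d := by omega
    have h1 : ∑ s ∈ Ico (c + 1 + 1) (d + 1 + 1), (x s - θ s) ^ 2
        = ∑ s ∈ Ico (c + 1) (d + 1), (avg (fun t => θ t + z t) (c + 1) s - θ (s + 1)) ^ 2 := by
      rw [← sum_Ico_add' (fun s => (x s - θ s) ^ 2)]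
      refine sum_congr rfl fun s hs => ?_
      rw [mem_Ico] at hs
      rw [hx s hs.1 hs.2]
    have h2 := sum_sq_sub_avg_add_le (θ := θ) ha hcd (by omega : d < n)
      (fun s h1 h2 => hz.avg (c + 1) s ha h1 h2)
    have h3 := sqDev_le_of_smallNoise hσ hρ hz ha hcd (by omega) (hR d hcd (by omega))
    have h4 : cbrt (((d + 1 - (c + 1) : ℕ) : ℝ) ^ 2 * sqVar θ (c + 1) d)
        ≤ cbrt (((d + 1 + 1 - (c + 1) : ℕ) : ℝ) ^ 2 * sqVar θ (c + 1) (d + 1)) := by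
      apply cbrt_le_cbrt (mul_nonneg (by positivity) (sqVar_nonneg _ _ _))
      have : ((d + 1 - (c + 1) : ℕ) : ℝ) ≤ ((d + 1 + 1 - (c + 1) : ℕ) : ℝ) := by
        exact_mod_cast (by omega)
      exact mul_le_mul (pow_le_pow_left₀ (by positivity) this 2)
        (sqVar_mono θ le_rfl d.le_succ) (sqVar_nonneg _ _ _) (by positivity)
    have h5 : 8 * sqDev θ (c + 1) d
        ≤ binBound σ (72 * Nat.clog 2 n * (β * Real.log n)) θ (c + 1) (d + 1) := by
      unfold binBound
      have h6 : 0 ≤ 72 * (Nat.clog 2 n : ℝ) * (β * Real.log n) * cbrt (σ ^ 4) :=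
        mul_nonneg (by positivity) (cbrt_nonneg (by positivity))
      have := mul_le_mul_of_nonneg_left h4 h6
      linarith
    have h6 : (θ (c + 1) - θ c) ^ 2 + (θ (d + 1) - θ d) ^ 2 ≤ sqVar θ c (d + 1) := by
      rw [sqVar_succ_top (by omega)]
      have : (θ (c + 1) - θ c) ^ 2 ≤ sqVar θ c d :=
        single_le_sum (f := fun s => (θ (s + 1) - θ s) ^ 2) (fun _ _ => sq_nonneg _)
          (mem_Ico.2 ⟨le_rfl, by omega⟩)
      linarith
    rw [h1]
    nlinarith [sq_nonneg (θ (d + 1) - θ d), sq_nonneg (θ (c + 1) - θ c)]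

/-- The coefficient of the main term of the regret bound. -/
def mainCoeff (n : ℕ) (β : ℝ) : ℝ :=
  Nat.clog 2 n * (β * Real.log n) * (72 + 2 * (4 + 2 * Real.log n))

lemma mainCoeff_nonneg (hρ : 1 ≤ β * Real.log n) : 0 ≤ mainCoeff n β := by
  have hlog : 0 ≤ Real.log n := Real.log_natCast_nonneg n
  unfold mainCoeff
  positivity

lemma binBound_le_mainCoeff (hρ : 1 ≤ β * Real.log n) (a b : ℕ) :
    binBound σ (72 * Nat.clog 2 n * (β * Real.log n)) θ a b
      ≤ binBound σ (mainCoeff n β) θ a b := by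
  have hlog : 0 ≤ Real.log n := Real.log_natCast_nonneg n
  refine mul_le_mul_of_nonneg_right ?_ (mul_nonneg (cbrt_nonneg (by positivity))
      (cbrt_nonneg (mul_nonneg (by positivity) (sqVar_nonneg _ _ _))))
  have : 0 ≤ (Nat.clog 2 n : ℝ) * (β * Real.log n) := by positivity
  unfold mainCoeff
  nlinarith

lemma sum_completed_bin_le (hσ : 0 ≤ σ) (hn : 2 ≤ n) (hρ : 1 ≤ β * Real.log n)
    (hz0 : z 0 = 0) (hz : SmallNoise n (σ * √(β * Real.log n)) z) {a b : ℕ} (ha : 1 ≤ a)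
    (hab : a ≤ b) (hb : b ≤ n)
    (hR : ∀ s, a ≤ s → s < b → ¬ Restart n σ β (fun t => θ t + z t) a s)
    (hRb : Restart n σ β (fun t => θ t + z t) a b)
    {x : ℕ → ℝ} (hx0 : x a = θ (a - 1) + z (a - 1))
    (hx : ∀ s, a ≤ s → s < b → x (s + 1) = avg (fun t => θ t + z t) a s) :
    ∑ s ∈ Ico a (b + 1), (x s - θ s) ^ 2
      ≤ 6 * sqVar θ (a - 1) b + binBound σ (mainCoeff n β) θ a b := by
  refine (sum_bin_le hσ hρ hz0 hz ha hab hb hR hx0 hx).trans ?_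
  have h1 := sq_threshold_le_of_restart hσ hn hρ hz ha hab hb hRb
  have hlog : 0 ≤ Real.log n := Real.log_natCast_nonneg n
  -- The absorbed noise term is the second summand in `mainCoeff`.
  have h2 := mul_le_mul_of_nonneg_right h1 (by linarith : 0 ≤ 4 + 2 * Real.log n)
  unfold binBound mainCoeff
  linarith

/-- Hölder: lengths add up, and squared variations do so up to the nonnegative increment between the
bins. -/
lemma binBound_add_le {κ : ℝ} (hκ : 0 ≤ κ) {a b : ℕ} (ha : 1 ≤ a) (hab : a ≤ b) :
    binBound σ κ θ 1 (a - 1) + binBound σ κ θ a b ≤ binBound σ κ θ 1 b := by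
  unfold binBound
  rw [← mul_add, ← mul_add]
  refine mul_le_mul_of_nonneg_left (mul_le_mul_of_nonneg_left ?_ (cbrt_nonneg (by positivity))) hκ
  refine (cbrt_sq_mul_add_le (by positivity) (sqVar_nonneg _ _ _) (by positivity)
    (sqVar_nonneg _ _ _)).trans ?_
  have e : ((a - 1 + 1 - 1 : ℕ) : ℝ) + ((b + 1 - a : ℕ) : ℝ) = ((b + 1 - 1 : ℕ) : ℝ) := by
    exact_mod_cast (by omega)
  rw [e]
  refine cbrt_le_cbrt (mul_nonneg (by positivity)
    (add_nonneg (sqVar_nonneg _ _ _) (sqVar_nonneg _ _ _))) ?_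
  refine mul_le_mul_of_nonneg_left ?_ (by positivity)
  calc sqVar θ 1 (a - 1) + sqVar θ a b ≤ sqVar θ 1 a + sqVar θ a b := by
        linarith [sqVar_mono θ (le_refl 1) (Nat.sub_le a 1)]
    _ = sqVar θ 1 b := sum_Ico_consecutive _ ha hab

/-- The situation at the end of round `t`. -/
structure Invariant (n : ℕ) (σ β : ℝ) (θ z : ℕ → ℝ) (t a : ℕ) : Prop where
  one_le : 1 ≤ a
  le : a ≤ t + 1
  not_restart : ∀ s, a ≤ s → s ≤ t → ¬ Restart n σ β (fun t => θ t + z t) a s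
  first : forecast n σ β (fun t => θ t + z t) a = θ (a - 1) + z (a - 1)
  later : ∀ s, a ≤ s → s ≤ t →
    forecast n σ β (fun t => θ t + z t) (s + 1) = avg (fun t => θ t + z t) a s
  sum_le : ∑ s ∈ Ico 1 a, (forecast n σ β (fun t => θ t + z t) s - θ s) ^ 2
    ≤ 6 * sqVar θ 0 (a - 1) + binBound σ (mainCoeff n β) θ 1 (a - 1)

/-- Only completed bins enter the error sum; a restart closes the current bin and merges its bound
into the running one. -/
lemma invariant (hσ : 0 ≤ σ) (hn : 2 ≤ n) (hρ : 1 ≤ β * Real.log n)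
    (hz0 : z 0 = 0) (hz : SmallNoise n (σ * √(β * Real.log n)) z) (t : ℕ) (ht : t ≤ n) :
    Invariant n σ β θ z t (state n σ β (fun t => θ t + z t) t).th := by
  induction t with
  | zero =>
    refine ⟨le_rfl, le_rfl, ?_, ?_, ?_, ?_⟩
    · intro s h1 h2
      simp only [state] at h1
      omega
    · simp [state, forecast]
    · intro s h1 h2
      simp only [state] at h1
      omega
    · simp [state, sqVar, binBound, cbrt]
  | succ t ih =>
    have I := ih (by omega)
    set a := (state n σ β (fun t => θ t + z t) t).th
    by_cases hR : Restart n σ β (fun t => θ t + z t) a (t + 1)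
    · have hst : state n σ β (fun t => θ t + z t) (t + 1) = ⟨t + 2, true⟩ := by
        rw [state, if_pos hR]
      rw [hst]
      refine ⟨by simp, le_rfl, fun s h1 h2 => ?_, ?_, fun s h1 h2 => ?_, ?_⟩
      · simp only at h1; omega
      · simp [forecast, hst]
      · simp only at h1; omega
      · simp only
        have h1 := sum_completed_bin_le hσ hn hρ hz0 hz I.one_le I.le ht
          (fun s h1 h2 => I.not_restart s h1 (by omega)) hR
          (x := forecast n σ β (fun t => θ t + z t)) I.first
          (fun s h1 h2 => I.later s h1 (by omega))
        have h2 := I.sum_le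
        have h3 := binBound_add_le (σ := σ) (θ := θ) (mainCoeff_nonneg hρ) I.one_le I.le
        have h4 : sqVar θ 0 (a - 1) + sqVar θ (a - 1) (t + 1) = sqVar θ 0 (t + 1) :=
          sum_Ico_consecutive _ (by omega) (by have := I.le; omega)
        have h5 := sum_Ico_consecutive
          (fun s => (forecast n σ β (fun t => θ t + z t) s - θ s) ^ 2) I.one_le
          (by have := I.le; omega : a ≤ t + 1 + 1)
        have h6 : t + 2 - 1 = t + 1 := by omega
        rw [h6]
        linarith
    · have hst : state n σ β (fun t => θ t + z t) (t + 1) = ⟨a, false⟩ := by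
        rw [state, if_neg hR]
      rw [hst]
      refine ⟨I.one_le, I.le.trans (by omega), fun s h1 h2 => ?_, I.first, fun s h1 h2 => ?_,
        I.sum_le⟩
      · rcases h2.eq_or_lt with rfl | h2
        · exact hR
        · exact I.not_restart s h1 (by omega)
      · rcases h2.eq_or_lt with rfl | h2
        · simp [forecast, hst]
        · exact I.later s h1 (by omega)

/-- The regret bound on the event that the noise is small. -/
lemma dynamicRegret_le_of_smallNoise (hσ : 0 ≤ σ) (hn : 2 ≤ n) (hρ : 1 ≤ β * Real.log n)
    (hz0 : z 0 = 0) (hz : SmallNoise n (σ * √(β * Real.log n)) z) :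
    dynamicRegret n θ (forecast n σ β (fun t => θ t + z t))
      ≤ 6 * sqVar θ 0 n + binBound σ (mainCoeff n β) θ 1 n
        + σ ^ 2 * (β * Real.log n) * (4 + 2 * Real.log n) := by
  have I := invariant (θ := θ) hσ hn hρ hz0 hz n le_rfl
  rw [dynamicRegret_eq]
  generalize (state n σ β (fun t => θ t + z t) n).th = a at I
  have hlog : 0 ≤ Real.log n := Real.log_natCast_nonneg n
  have hlam : (σ * √(β * Real.log n)) ^ 2 = σ ^ 2 * (β * Real.log n) := by
    rw [mul_pow, Real.sq_sqrt (by linarith)]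
  have hl : 0 ≤ σ ^ 2 * (β * Real.log n) * (4 + 2 * Real.log n) := by positivity
  -- Either round `n` restarted and no bin is open, or the open bin pays its noise term once.
  rcases I.le.eq_or_lt with h | h
  · have h1 := I.sum_le
    subst h
    rw [Nat.add_sub_cancel] at h1
    linarith
  · have han : a ≤ n := by omega
    have h1 := sum_bin_le hσ hρ hz0 hz I.one_le han le_rfl
      (fun s h1 h2 => I.not_restart s h1 h2.le)
      (x := forecast n σ β (fun t => θ t + z t)) I.first
      (fun s h1 h2 => I.later s h1 h2.le)
    have h2 := I.sum_le
    have h3 := binBound_add_le (σ := σ) (θ := θ) (mainCoeff_nonneg hρ) I.one_le han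
    have h4 : sqVar θ 0 (a - 1) + sqVar θ (a - 1) n = sqVar θ 0 n :=
      sum_Ico_consecutive _ (by omega) (by omega)
    have h5 := sum_Ico_consecutive
      (fun s => (forecast n σ β (fun t => θ t + z t) s - θ s) ^ 2) I.one_le I.le
    have h6 := binBound_le_mainCoeff (σ := σ) (θ := θ) hρ a n
    rw [hlam] at h1
    linarith

end Policy

end Arrows

namespace Arrows

open Finset MeasureTheory ProbabilityTheory

/-! ### The noise is small with high probability -/

/-- Recentring is a self-adjoint projection, so it moves from the noise to the weights and leaves a
linear form in independent variables. -/
lemma haarCoeff_padded_eq (z : ℕ → ℝ) {a b : ℕ} (r : ℕ) :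
    haarCoeff (padLog a b) (padded z a b) r
      = ∑ s ∈ Icc a b, (haarEntry (padLog a b) r (s - a)
          - avg (fun s => haarEntry (padLog a b) r (s - a)) a b) * z s := by
  set m := padLog a b
  set g : ℕ → ℝ := fun s => haarEntry m r (s - a) with hg
  have h1 : haarCoeff m (padded z a b) r = ∑ s ∈ Icc a b, g s * (z s - avg z a b) := by
    have e : haarCoeff m (padded z a b) r
        = ∑ j ∈ range (b + 1 - a), haarEntry m r j * padded z a b j := by
      symm
      apply sum_subset (range_subset_range.2 (le_two_pow_padLog a b))
      intro j _ hj
      rw [mem_range] at hj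
      rw [padded, if_neg (by omega), mul_zero]
    have h2 : Icc a b = Ico a (b + 1) := by ext; simp
    rw [e, h2, sum_Ico_eq_sum_range]
    refine sum_congr rfl fun j hj => ?_
    rw [mem_range] at hj
    rw [padded, if_pos (by omega), hg]
    simp
  have h2 : (∑ s ∈ Icc a b, g s) * avg z a b = avg g a b * ∑ s ∈ Icc a b, z s := by
    unfold avg
    ring
  rw [h1]
  simp only [mul_sub, sub_mul, sum_sub_distrib, ← sum_mul, ← mul_sum]
  rw [h2]

lemma sqDev_le_sum_sq (θ : ℕ → ℝ) {a b : ℕ} (h : a ≤ b) :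
    sqDev θ a b ≤ ∑ s ∈ Icc a b, θ s ^ 2 := by
  rw [sqDev_eq θ h]
  have : 0 ≤ (∑ s ∈ Icc a b, θ s) ^ 2 / ((b + 1 - a : ℕ) : ℝ) := by positivity
  linarith

lemma sum_weight_sq_le {a b r : ℕ} (h : a ≤ b) (hr : r < 2 ^ padLog a b) :
    ∑ s ∈ Icc a b, (haarEntry (padLog a b) r (s - a)
          - avg (fun s => haarEntry (padLog a b) r (s - a)) a b) ^ 2 ≤ 1 := by
  refine (sqDev_le_sum_sq (fun s => haarEntry (padLog a b) r (s - a)) h).trans ?_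
  refine le_trans ?_ (sum_haarEntry_sq_le hr)
  have h2 : Icc a b = Ico a (b + 1) := by ext; simp
  rw [h2, sum_Ico_eq_sum_range]
  simp only [Nat.add_sub_cancel_left]
  exact sum_le_sum_of_subset_of_nonneg (range_subset_range.2 (le_two_pow_padLog a b))
    fun _ _ _ => sq_nonneg _

section Tail

variable {Ω : Type*} [MeasurableSpace Ω] {P : Measure Ω}

lemma hasSubgaussianMGF_mono {X : Ω → ℝ} {c c' : NNReal} (h : HasSubgaussianMGF X c P)
    (hc : c ≤ c') : HasSubgaussianMGF X c' P where
  integrable_exp_mul := h.integrable_exp_mul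
  mgf_le t := (h.mgf_le t).trans <| by
    have : (c : ℝ) ≤ c' := hc
    gcongr

/-- The strict inequality keeps the bound true for `σ = 0`, where `X` vanishes almost surely and the
Chernoff exponent degenerates. -/
lemma measureReal_lt_abs_le [IsProbabilityMeasure P] {X : Ω → ℝ} {σ : NNReal} {ρ : ℝ}
    (hρ : 0 ≤ ρ) (h : HasSubgaussianMGF X (σ ^ 2) P) :
    P.real {ω | σ * √ρ < |X ω|} ≤ 2 * Real.exp (-(ρ / 2)) := by
  rcases eq_or_ne σ 0 with rfl | hσ
  · rw [zero_pow (by norm_num)] at h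
    have h0 := ae_iff.1 h.ae_eq_zero_of_hasSubgaussianMGF_zero
    have : P.real {ω | ((0 : NNReal) : ℝ) * √ρ < |X ω|} = 0 := by
      rw [measureReal_eq_zero_iff]
      simpa using h0
    rw [this]
    positivity
  · have hσ' : (σ : ℝ) ≠ 0 := by exact_mod_cast hσ
    have e : -((σ : ℝ) * √ρ) ^ 2 / (2 * ((σ ^ 2 : NNReal) : ℝ)) = -(ρ / 2) := by
      rw [mul_pow, Real.sq_sqrt hρ]
      push_cast
      field_simp
    have hnn : 0 ≤ (σ : ℝ) * √ρ := by positivity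
    have h1 := h.measure_ge_le hnn
    have h2 := h.neg.measure_ge_le hnn
    rw [e] at h1 h2
    calc P.real {ω | σ * √ρ < |X ω|}
        ≤ P.real ({ω | σ * √ρ ≤ X ω} ∪ {ω | σ * √ρ ≤ (-X) ω}) := by
          refine measureReal_mono fun ω hω => ?_
          rw [Set.mem_ofPred_eq] at hω
          rcases lt_abs.1 hω with h | h
          · exact .inl h.le
          · exact .inr h.le
      _ ≤ _ := measureReal_union_le _ _
      _ ≤ _ := by linarith

variable {n : ℕ} {σ : NNReal} {Z : ℕ → Ω → ℝ}

lemma hasSubgaussianMGF_weighted_sum (hindep : iIndepFun (fun t : Icc 1 n => Z t) P)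
    (hsub : ∀ t ∈ Icc 1 n, HasSubgaussianMGF (Z t) (σ ^ 2) P) {s : Finset ℕ} (hs : s ⊆ Icc 1 n)
    (w : ℕ → ℝ) (hw : ∑ t ∈ s, w t ^ 2 ≤ 1) :
    HasSubgaussianMGF (fun ω => ∑ t ∈ s, w t * Z t ω) (σ ^ 2) P := by
  have hterm : ∀ t : Icc 1 n,
      HasSubgaussianMGF (fun ω => w t * Z t ω) (Real.toNNReal (w t ^ 2) * σ ^ 2) P := by
    intro t
    have e := (Real.toNNReal_of_nonneg (sq_nonneg (w t))).symm
    exact hasSubgaussianMGF_mono ((hsub t t.2).const_mul (w t))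
      (le_of_eq (congrArg (· * σ ^ 2) e))
  have h1 := HasSubgaussianMGF.sum_of_iIndepFun
    (hindep.comp (fun t x => w t * x) fun t => measurable_const_mul (w t))
    (c := fun t => Real.toNNReal (w t ^ 2) * σ ^ 2)
    (s := univ.filter fun t : Icc 1 n => (t : ℕ) ∈ s)
    (fun t _ => hterm t)
  have e : ∀ f : ℕ → ℝ, ∑ t ∈ univ.filter (fun t : Icc 1 n => (t : ℕ) ∈ s), f t
      = ∑ t ∈ s, f t := by
    intro f
    rw [sum_filter, univ_eq_attach, sum_attach (Icc 1 n) (fun t => if t ∈ s then f t else 0),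
      ← sum_filter, filter_mem_eq_inter, inter_eq_right.2 hs]
  have h2 : HasSubgaussianMGF (fun ω => ∑ t ∈ s, w t * Z t ω) _ P :=
    h1.congr (ae_of_all _ fun ω => e fun t => w t * Z t ω)
  refine hasSubgaussianMGF_mono h2 ?_
  rw [← sum_mul]
  refine mul_le_of_le_one_left (by positivity) ?_
  rw [← NNReal.coe_le_coe]
  push_cast
  simp only [Real.coe_toNNReal _ (sq_nonneg _)]
  rwa [e fun t => w t ^ 2]

/-- Union bound over `2 n ^ 3` Haar coefficients and `n ^ 2` averages, each with a two-sided tail.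
-/
lemma measureReal_not_smallNoise_le [IsProbabilityMeasure P] {ρ : ℝ} (hρ : 0 ≤ ρ)
    (hindep : iIndepFun (fun t : Icc 1 n => Z t) P)
    (hsub : ∀ t ∈ Icc 1 n, HasSubgaussianMGF (Z t) (σ ^ 2) P) {z : Ω → ℕ → ℝ}
    (hz : ∀ ω, ∀ t ∈ Icc 1 n, z ω t = Z t ω) :
    P.real {ω | ¬ SmallNoise n (σ * √ρ) (z ω)} ≤ 6 * n ^ 3 * Real.exp (-(ρ / 2)) := by
  have hε : 0 ≤ 2 * Real.exp (-(ρ / 2)) := by positivity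
  have tail : ∀ a b, 1 ≤ a → b ≤ n → ∀ w : ℕ → ℝ, ∑ t ∈ Icc a b, w t ^ 2 ≤ 1 →
      P.real {ω | σ * √ρ < |∑ t ∈ Icc a b, w t * z ω t|} ≤ 2 * Real.exp (-(ρ / 2)) := by
    intro a b ha hb w hw
    have hs : Icc a b ⊆ Icc 1 n := Icc_subset_Icc ha hb
    refine le_trans (le_of_eq ?_)
      (measureReal_lt_abs_le hρ (hasSubgaussianMGF_weighted_sum hindep hsub hs w hw))
    congr with ω
    rw [sum_congr rfl fun t ht => by rw [hz ω t (hs ht)]]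
  let B₁ : (ℕ × ℕ) × ℕ → Set Ω := fun p => {ω | (p.1.1 ≤ p.1.2 ∧ p.2 < 2 ^ padLog p.1.1 p.1.2) ∧
    σ * √ρ < |haarCoeff (padLog p.1.1 p.1.2) (padded (z ω) p.1.1 p.1.2) p.2|}
  let B₂ : ℕ × ℕ → Set Ω := fun p => {ω | p.1 ≤ p.2 ∧
    (σ * √ρ) ^ 2 < avg (z ω) p.1 p.2 ^ 2 * (p.2 + 1 - p.1 : ℕ)}
  let T₂ := Icc 1 n ×ˢ Icc 1 n
  -- Padding at most doubles the length, so all row indices are below `2 * n`.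
  let T₁ := T₂ ×ˢ range (2 * n)
  have hB₁ : ∀ p ∈ T₁, P.real (B₁ p) ≤ 2 * Real.exp (-(ρ / 2)) := by
    rintro ⟨⟨a, b⟩, r⟩ hp
    simp only [T₁, T₂, mem_product, mem_Icc, mem_range] at hp
    by_cases h : a ≤ b ∧ r < 2 ^ padLog a b
    · refine le_trans (measureReal_mono ?_) (tail a b hp.1.1.1 hp.1.2.2 _
        (sum_weight_sq_le h.1 h.2))
      rintro ω ⟨_, hω⟩
      rw [haarCoeff_padded_eq] at hω
      exact hω
    · have : B₁ ((a, b), r) = ∅ := Set.eq_empty_of_forall_notMem fun ω hω => h hω.1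
      rwa [this, measureReal_empty]
  have hB₂ : ∀ p ∈ T₂, P.real (B₂ p) ≤ 2 * Real.exp (-(ρ / 2)) := by
    rintro ⟨a, b⟩ hp
    simp only [T₂, mem_product, mem_Icc] at hp
    by_cases h : a ≤ b
    · have hc : (0 : ℝ) < ((b + 1 - a : ℕ) : ℝ) := by exact_mod_cast (by omega : 0 < b + 1 - a)
      refine le_trans (measureReal_mono ?_) (tail a b hp.1.1 hp.2.2
        (fun _ => 1 / √((b + 1 - a : ℕ) : ℝ)) (le_of_eq ?_))
      · rintro ω ⟨_, hω⟩
        rw [Set.mem_ofPred_eq]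
        refine lt_of_pow_lt_pow_left₀ 2 (abs_nonneg _) (hω.trans_le (le_of_eq ?_))
        simp only
        rw [sq_abs, ← mul_sum, mul_pow, div_pow, one_pow, Real.sq_sqrt hc.le, avg, Nat.card_Icc]
        field_simp
      · rw [sum_const, Nat.card_Icc, nsmul_eq_mul, div_pow, one_pow, Real.sq_sqrt hc.le,
          mul_one_div_cancel hc.ne']
    · have : B₂ (a, b) = ∅ := Set.eq_empty_of_forall_notMem fun ω hω => h hω.1
      rwa [this, measureReal_empty]
  have hsubset : {ω | ¬ SmallNoise n (σ * √ρ) (z ω)} ⊆ (⋃ p ∈ T₁, B₁ p) ∪ ⋃ p ∈ T₂, B₂ p := by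
    intro ω hω
    by_contra hnot
    simp only [Set.mem_union, Set.mem_iUnion, not_or, not_exists] at hnot
    refine hω ⟨fun a b ha hab hb r hr => ?_, fun a b ha hab hb => ?_⟩
    · by_contra hlt
      refine hnot.1 ((a, b), r) ?_ ⟨⟨hab, hr⟩, not_le.1 hlt⟩
      have := two_pow_padLog_le hab
      simp only [T₁, T₂, mem_product, mem_Icc, mem_range]
      omega
    · by_contra hlt
      refine hnot.2 (a, b) ?_ ⟨hab, not_le.1 hlt⟩
      simp only [T₂, mem_product, mem_Icc]
      omega
  have hcard₂ : (T₂.card : ℝ) = n ^ 2 := by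
    simp only [T₂, card_product, Nat.card_Icc, Nat.add_sub_cancel]
    push_cast; ring
  have hcard₁ : (T₁.card : ℝ) = 2 * n ^ 3 := by
    simp only [T₁, T₂, card_product, Nat.card_Icc, Nat.add_sub_cancel, card_range]
    push_cast; ring
  have hn : (n : ℝ) ^ 2 ≤ n ^ 3 := by
    rcases Nat.eq_zero_or_pos n with rfl | h
    · simp
    · exact pow_le_pow_right₀ (by exact_mod_cast h) (by norm_num)
  calc _ ≤ _ := measureReal_mono hsubset
    _ ≤ _ := measureReal_union_le _ _
    _ ≤ ∑ p ∈ T₁, P.real (B₁ p) + ∑ p ∈ T₂, P.real (B₂ p) :=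
      add_le_add (measureReal_biUnion_finset_le _ _) (measureReal_biUnion_finset_le _ _)
    _ ≤ T₁.card • (2 * Real.exp (-(ρ / 2))) + T₂.card • (2 * Real.exp (-(ρ / 2))) :=
      add_le_add (sum_le_card_nsmul _ _ _ hB₁) (sum_le_card_nsmul _ _ _ hB₂)
    _ ≤ _ := by
      rw [nsmul_eq_mul, nsmul_eq_mul, hcard₁, hcard₂]
      nlinarith [mul_le_mul_of_nonneg_right hn hε]

end Tail

/-! ### Constants -/

lemma six_mul_exp_le {n : ℕ} (hn : 2 ≤ n) {δ : ℝ} (hδ : 0 < δ) (hδ1 : δ ≤ 1) :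
    6 * (n : ℝ) ^ 3 * Real.exp (-((24 * Real.log n + 8 * Real.log (8 / δ)) / 2)) ≤ δ := by
  have hn0 : (0 : ℝ) < n := by positivity
  have hl : 0 ≤ Real.log n := Real.log_natCast_nonneg n
  have hd : 0 ≤ Real.log (8 / δ) := Real.log_nonneg (by rw [le_div_iff₀ hδ]; linarith)
  have h1 : Real.exp (-((24 * Real.log n + 8 * Real.log (8 / δ)) / 2))
      ≤ Real.exp (-(3 * Real.log n + Real.log (8 / δ))) := Real.exp_le_exp.2 (by linarith)
  have h2 : Real.exp (-(3 * Real.log n + Real.log (8 / δ))) = ((n : ℝ) ^ 3)⁻¹ * (δ / 8) := by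
    rw [neg_add, Real.exp_add, Real.exp_neg, Real.exp_neg, Real.exp_log (by positivity), inv_div,
      show (3 : ℝ) * Real.log n = ((3 : ℕ) : ℝ) * Real.log n by norm_num, Real.exp_nat_mul,
      Real.exp_log hn0]
  calc _ ≤ 6 * (n : ℝ) ^ 3 * (((n : ℝ) ^ 3)⁻¹ * (δ / 8)) := by
        rw [← h2]
        exact mul_le_mul_of_nonneg_left h1 (by positivity)
    _ = 6 / 8 * δ := by field_simp
    _ ≤ δ := by linarith

lemma clog_two_le {n : ℕ} (hn : 2 ≤ n) : (Nat.clog 2 n : ℝ) ≤ 1 + Real.log n / Real.log 2 := by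
  have h1 := Nat.pow_pred_clog_lt_self (b := 2) (by norm_num) (by omega : 1 < n)
  have h2 := Nat.clog_pos (b := 2) (by norm_num) hn
  obtain ⟨k, hk⟩ : ∃ k, Nat.clog 2 n = k + 1 := ⟨Nat.clog 2 n - 1, by omega⟩
  rw [hk, Nat.pred_eq_sub_one, Nat.add_sub_cancel] at h1
  rw [hk]
  have h3 : ((2 : ℝ) ^ k) ≤ n := by exact_mod_cast h1.le
  have h4 := Real.log_le_log (by positivity) h3
  rw [Real.log_pow] at h4
  have h5 : (k : ℝ) ≤ Real.log n / Real.log 2 := by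
    rwa [le_div_iff₀ (Real.log_pos (by norm_num))]
  push_cast
  linarith

/-- The constants of the deterministic regret bound, in terms of `x = log (n / δ)`. -/
lemma constants_le {n : ℕ} (hn : 2 ≤ n) {δ β : ℝ} (hδ : 0 < δ) (hδ1 : δ ≤ 1)
    (hρ : β * Real.log n = 24 * Real.log n + 8 * Real.log (8 / δ)) :
    6 ≤ 20000 * Real.log (n / δ) ^ 3 ∧ mainCoeff n β ≤ 20000 * Real.log (n / δ) ^ 3 ∧
      β * Real.log n * (4 + 2 * Real.log n) ≤ 20000 * Real.log (n / δ) ^ 3 := by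
  have hn0 : (2 : ℝ) ≤ n := by exact_mod_cast hn
  have hl2 := Real.log_two_gt_d9
  have hl : 0 ≤ Real.log n := Real.log_natCast_nonneg n
  have hX1 : Real.log n ≤ Real.log (n / δ) :=
    Real.log_le_log (by linarith) (by rw [le_div_iff₀ hδ]; nlinarith)
  have hX2 : Real.log 2 ≤ Real.log n := Real.log_le_log (by norm_num) hn0
  -- From `8 / δ ≤ (n / δ) ^ 3`, as `n ≥ 2` and `δ ≤ 1`.
  have hd : Real.log (8 / δ) ≤ 3 * Real.log (n / δ) := by
    have h8 : Real.log (8 / δ) ≤ Real.log ((n / δ) ^ 3) := by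
      apply Real.log_le_log (by positivity)
      rw [div_pow, div_le_div_iff₀ hδ (by positivity)]
      have h1 : (8 : ℝ) ≤ n ^ 3 := by
        calc (8 : ℝ) = 2 ^ 3 := by norm_num
          _ ≤ _ := pow_le_pow_left₀ (by norm_num) hn0 3
      have h2 : δ ^ 3 ≤ δ := by nlinarith [mul_nonneg hδ.le (by linarith : 0 ≤ 1 - δ)]
      nlinarith [pow_pos hδ 3]
    rwa [Real.log_pow] at h8
  have hM := clog_two_le hn
  have hq : Real.log n / Real.log 2 ≤ 3 / 2 * Real.log n := by
    rw [div_le_iff₀ (by linarith)]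
    nlinarith
  have hρ0 : 0 ≤ β * Real.log n := by
    have : 0 ≤ Real.log (8 / δ) := Real.log_nonneg (by rw [le_div_iff₀ hδ]; linarith)
    linarith
  set X := Real.log (n / δ)
  have hX : 2 / 3 ≤ X := by linarith
  have hρX : β * Real.log n ≤ 48 * X := by linarith
  have hMX : (Nat.clog 2 n : ℝ) ≤ 3 * X := by linarith
  have hX3 : 2 / 3 * X ^ 2 ≤ X ^ 3 := by nlinarith [sq_nonneg X]
  have hX2' : 2 / 3 * X ≤ X ^ 2 := by nlinarith
  have hX0 : 0 ≤ X := by linarith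
  refine ⟨by linarith, ?_, ?_⟩
  · unfold mainCoeff
    -- `72 + 8 + 4 * X ≤ 124 * X` since `X ≥ 2 / 3`; and `3 * 48 * 124 = 17856 ≤ 20000`.
    calc _ ≤ 3 * X * (48 * X) * (124 * X) := by
          refine mul_le_mul (mul_le_mul hMX hρX hρ0 (by positivity)) (by linarith)
            (by linarith) (by positivity)
      _ ≤ _ := by nlinarith [pow_nonneg hX0 3]
  · calc _ ≤ 48 * X * (8 * X) :=
          mul_le_mul hρX (by linarith) (by linarith) (by positivity)
      _ ≤ _ := by nlinarith

lemma sqVar_one_eq_norm_sq (n : ℕ) (θ : ℕ → ℝ) : sqVar θ 1 n = ‖discreteDiff n θ‖ ^ 2 := by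
  rw [EuclideanSpace.norm_sq_eq, sqVar, sum_Ico_eq_sum_range]
  simp only [discreteDiff, Real.norm_eq_abs, sq_abs]
  rw [Fin.sum_univ_eq_sum_range (fun i => (θ (i + 2) - θ (i + 1)) ^ 2)]
  refine sum_congr rfl fun i _ => ?_
  congr 3 <;> ring_nf

lemma cbrt_mul_cbrt_eq {n : ℕ} {s C : ℝ} (hs : 0 ≤ s) (hC : 0 ≤ C) :
    cbrt (s ^ 4) * cbrt ((n : ℝ) ^ 2 * C ^ 2)
      = (n : ℝ) ^ (2 / 3 : ℝ) * C ^ (2 / 3 : ℝ) * s ^ (4 / 3 : ℝ) := by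
  have e : ∀ {x : ℝ} (k : ℕ), 0 ≤ x → cbrt (x ^ k) = x ^ ((k : ℝ) / 3) := by
    intro x k hx
    rw [cbrt, ← Real.rpow_natCast, ← Real.rpow_mul hx, mul_one_div]
  rw [cbrt_mul (by positivity) (by positivity), e 4 hs, e 2 hC, e 2 (Nat.cast_nonneg n)]
  push_cast
  ring

end Arrows

end

/-- There are absolute constants `K` and `p` such that, with probability at least `1 - δ`, the policy
has dynamic regret at most
`K log(n/δ)^p (n^{2/3} C^{2/3} σ^{4/3} + U² + C² + σ²)` on the discrete Sobolev class of radius `C`. -/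
theorem corollary2 :
    ∃ K : ℝ, 0 < K ∧ ∃ p : ℕ,
      ∀ (Ω : Type*) [MeasurableSpace Ω] (P : MeasureTheory.Measure Ω)
        [MeasureTheory.IsProbabilityMeasure P]
        (n : ℕ) (σ : NNReal) (δ β C U : ℝ) (θ : ℕ → ℝ) (Z : ℕ → Ω → ℝ),
        2 ≤ n → 0 < δ → δ ≤ 1 →
        β = 24 + 8 * Real.log (8 / δ) / Real.log n →
        (∀ t ∈ Finset.Icc 1 n, Measurable (Z t)) →
        ProbabilityTheory.iIndepFun (fun t : Finset.Icc 1 n => Z t) P →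
        (∀ t ∈ Finset.Icc 1 n, ProbabilityTheory.HasSubgaussianMGF (Z t) (σ ^ 2) P) →
        θ ∈ Arrows.sobolevClass n C →
        |θ 1| ≤ U →
        1 - δ ≤ P.real {ω |
          Arrows.dynamicRegret n θ
              (Arrows.forecast n σ β (Arrows.feedback θ (fun t => Z t ω))) ≤
            K * Real.log (n / δ) ^ p *
              ((n : ℝ) ^ (2 / 3 : ℝ) * C ^ (2 / 3 : ℝ) * (σ : ℝ) ^ (4 / 3 : ℝ)
                + U ^ 2 + C ^ 2 + (σ : ℝ) ^ 2)} := by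
  refine ⟨20000, by norm_num, 3, ?_⟩
  intro Ω _ P _ n σ δ β C U θ Z hn hδ hδ1 hβ _ hindep hsub hθ hU
  have hn0 : (2 : ℝ) ≤ n := by exact_mod_cast hn
  have hl : Real.log 2 ≤ Real.log n := Real.log_le_log (by norm_num) hn0
  have hl2 := Real.log_two_gt_d9
  have hρ : β * Real.log n = 24 * Real.log n + 8 * Real.log (8 / δ) := by
    have : Real.log n ≠ 0 := by linarith
    rw [hβ]
    field_simp
  have hd : 0 ≤ Real.log (8 / δ) := Real.log_nonneg (by rw [le_div_iff₀ hδ]; linarith)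
  have hρ1 : 1 ≤ β * Real.log n := by linarith
  -- Zero signal and noise at time 0 make `y 0 = 0` an ordinary observation and `θ 1` an increment.
  let θ' : ℕ → ℝ := fun t => if t = 0 then 0 else θ t
  let z : Ω → ℕ → ℝ := fun ω t => if t = 0 then 0 else Z t ω
  have hbad : P.real {ω | ¬ Arrows.SmallNoise n (σ * √(β * Real.log n)) (z ω)} ≤ δ := by
    refine (Arrows.measureReal_not_smallNoise_le (by linarith) hindep hsub ?_).trans ?_
    · intro ω t ht
      rw [Finset.mem_Icc] at ht
      exact if_neg (by omega)
    · rw [hρ]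
      exact Arrows.six_mul_exp_le hn hδ hδ1
  have hgood : 1 - δ ≤ P.real {ω | Arrows.SmallNoise n (σ * √(β * Real.log n)) (z ω)} := by
    -- Subadditivity bounds the good event from below without its measurability.
    have h1 := MeasureTheory.measureReal_union_le (μ := P)
      {ω | Arrows.SmallNoise n (σ * √(β * Real.log n)) (z ω)}
      {ω | ¬ Arrows.SmallNoise n (σ * √(β * Real.log n)) (z ω)}
    have h2 : {ω | Arrows.SmallNoise n (σ * √(β * Real.log n)) (z ω)}
      ∪ {ω | ¬ Arrows.SmallNoise n (σ * √(β * Real.log n)) (z ω)} = Set.univ :=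
      Set.eq_univ_of_forall fun ω => em _
    rw [h2, MeasureTheory.probReal_univ] at h1
    linarith
  refine hgood.trans (MeasureTheory.measureReal_mono fun ω hω => ?_)
  have hfb : Arrows.feedback θ (fun t => Z t ω) = fun t => θ' t + z ω t := by
    funext t
    simp only [Arrows.feedback, θ', z]
    split_ifs <;> simp
  have hreg : ∀ x, Arrows.dynamicRegret n θ x = Arrows.dynamicRegret n θ' x := by
    intro x
    rw [Arrows.dynamicRegret_eq, Arrows.dynamicRegret_eq]
    refine Finset.sum_congr rfl fun t ht => ?_
    rw [Finset.mem_Ico] at ht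
    simp only [θ', if_neg (by omega : t ≠ 0)]
  have hmain := Arrows.dynamicRegret_le_of_smallNoise (θ := θ') σ.coe_nonneg hn hρ1
    (if_pos rfl) hω
  have hC : ‖Arrows.discreteDiff n θ‖ ≤ C := hθ
  have hC0 : 0 ≤ C := (norm_nonneg _).trans hC
  have hvar1 : Arrows.sqVar θ' 1 n ≤ C ^ 2 := by
    have e : Arrows.sqVar θ' 1 n = Arrows.sqVar θ 1 n := by
      refine Finset.sum_congr rfl fun t ht => ?_
      rw [Finset.mem_Ico] at ht
      simp only [θ', if_neg (by omega : t ≠ 0), if_neg (by omega : t + 1 ≠ 0)]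
    rw [e, Arrows.sqVar_one_eq_norm_sq]
    exact pow_le_pow_left₀ (norm_nonneg _) hC 2
  have hvar0 : Arrows.sqVar θ' 0 n ≤ U ^ 2 + C ^ 2 := by
    have h1 : Arrows.sqVar θ' 0 n = θ 1 ^ 2 + Arrows.sqVar θ' 1 n := by
      unfold Arrows.sqVar
      rw [Finset.sum_eq_sum_Ico_succ_bot (by omega)]
      simp [θ']
    have h2 : θ 1 ^ 2 ≤ U ^ 2 := sq_le_sq' (by linarith [neg_abs_le (θ 1)])
      ((le_abs_self _).trans hU)
    linarith
  obtain ⟨c1, c2, c3⟩ := Arrows.constants_le hn hδ hδ1 hρ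
  set κ := 20000 * Real.log (n / δ) ^ 3
  have h1 : 6 * Arrows.sqVar θ' 0 n ≤ κ * (U ^ 2 + C ^ 2) :=
    mul_le_mul c1 hvar0 (Arrows.sqVar_nonneg _ _ _) (by linarith)
  have h2 : Arrows.binBound σ (Arrows.mainCoeff n β) θ' 1 n
      ≤ κ * ((n : ℝ) ^ (2 / 3 : ℝ) * C ^ (2 / 3 : ℝ) * (σ : ℝ) ^ (4 / 3 : ℝ)) := by
    rw [← Arrows.cbrt_mul_cbrt_eq σ.coe_nonneg hC0]
    unfold Arrows.binBound
    have hD := Arrows.sqVar_nonneg θ' 1 n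
    have h4 : 0 ≤ Arrows.cbrt ((σ : ℝ) ^ 4) := Arrows.cbrt_nonneg (by positivity)
    rw [Nat.add_sub_cancel]
    refine mul_le_mul c2 (mul_le_mul_of_nonneg_left ?_ h4)
      (mul_nonneg h4 (Arrows.cbrt_nonneg (by positivity))) (by linarith)
    exact Arrows.cbrt_le_cbrt (by positivity) (mul_le_mul_of_nonneg_left hvar1 (by positivity))
  have h3 := mul_le_mul_of_nonneg_left c3 (sq_nonneg (σ : ℝ))
  rw [Set.mem_ofPred_eq, hfb, hreg]
  linarith
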